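/- Let $\mathcal V$ be a distributive category, that is, a category with finite products and arbitrary (small) coproducts such that finite products distribute over coproducts (for every object $X$ and every set-indexed family $(Y_i)_{i\in I}$ the canonical map $\coprod_i (X\times Y_i)\to X\times\coprod_i Y_i$ is an isomorphism). Let $\mathbb{M}\mathrm{at}(\mathcal V)$ be the (pseudo) double category of $\mathcal V$-matrices: objects are sets, arrows are functions, a proarrow $M: X \nrightarrow Y$ is a family of objects $M(x,y)\in\mathcal V$ for $(x,y)\in X\times Y$, a cell from $M: X\nrightarrow Y$ to $M': X'\nrightarrow Y'$ bounded by $f: X\to X'$ and $g: Y\to Y'$ is a family of morphisms $M(x,y)\to M'(f(x),g(y))$, external composition is $(M\odot N)(x,z)=\coprod_{y} M(x,y)\times N(y,z)$, and the identity proarrow $\mathrm{id}_X$ has the terminal object $1$ on the diagonal and the initial object $0$ off it. For a double category $\mathbb D$, let $\mathbb{F}\mathrm{in}\mathbb{F}\mathrm{am}^*(\mathbb D)$ be its contravariant double category of finite families. An object $(I,\vec x)$ is a finite set $I$ with objects $x_i$ of $\mathbb D$ for $i \in I$. An arrow $(I,\vec x)\to(J,\vec y)$ is a function $f_0:J\to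 I$ with arrows $f_j: x_{f_0(j)}\to y_j$. A proarrow $(A,\vec m):(I,\vec x)\nrightarrow(J,\vec y)$ is a span of finite sets $I\xleftarrow{\ell}A\xrightarrow{r}J$ with proarrows $m_a: x_{\ell(a)}\nrightarrow y_{r(a)}$ for $a \in A$. A cell from $(A,\vec m)$ to $(B,\vec n)$ bounded by $(f_0,f)$ and $(g_0,g)$ is a function $\alpha_0:B\to A$ with $\ell\alpha_0=f_0\ell$ and $r\alpha_0=g_0r$, together with cells $\alpha_b$ from $m_{\alpha_0(b)}$ to $n_b$ bounded by $f_{\ell(b)}$ and $g_{r(b)}$. Proarrows are composed by taking pullbacks of spans and composing componentwise in $\mathbb D$. Let $\Delta:\mathbb D\to\mathbb{F}\mathrm{in}\mathbb{F}\mathrm{am}^*(\mathbb D)$ be the double functor sending objects and proarrows to singleton families. Then $\mathbb D$ has iso-strong finite products when 1. $\mathbb D$ has lax finite products: $\Delta$ has a lax right adjoint $\Pi$ (an adjunction in the 2-category of double categories, lax double functors and natural transformations); 2. for all composable families $(I,\vec x)\overset{(A,\vec m)}{\nrightarrow}(J,\vec y)\overset{(B,\vec n)}{\nrightarrow}(K,\vec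 z)$ such that the legs $A\to J$ and $J\leftarrow B$ are bijections, the composition comparison cell $\Pi\vec m\odot\Pi\vec n\to\Pi(\vec m\odot\vec n)$ of $\Pi$ is an isomorphism; 3. for every family $(I,\vec x)$, the identity comparison cell $\mathrm{id}_{\Pi\vec x}\to\Pi(\mathrm{id}_{\vec x})$ of $\Pi$ is an isomorphism. **Proposition.** For any distributive category $\mathcal V$, the double category $\mathbb{M}\mathrm{at}(\mathcal V)$ has iso-strong finite products. -/

import Mathlib

open CategoryTheory Limits MonoidalCategory

universe w t v u v₁ v₂ v₃ v₄ v₅ v₆ u₁ u₂ u₃ u₄ u₅ u₆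

set_option linter.checkUnivs false

/-- A (pseudo) double category, presented by its category of objects and arrows `D₀`
(`Obj` with its category structure) and its category of proarrows and cells `D₁`: the objects of
`D₁` are the proarrows `m : Pro x y`, and `Cell m n` is the type of *all* morphisms `m ⟶ n` of `D₁`,
with arbitrary boundary arrows, which are recovered by the source and target
functors `left` and `right`. External composition is written in diagrammatic order;
it is defined on pairs of cells in `D₁ ×_{D₀} D₁`. -/
structure DblCat where
  Obj : Type u₁
  [cat : Category.{v₁} Obj]
  Pro : Obj → Obj → Type u₂
  Cell : ∀ {x y x' y' : Obj}, Pro x y → Pro x' y' → Type v₂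
  left : ∀ {x y x' y' : Obj} {m : Pro x y} {n : Pro x' y'}, Cell m n → (x ⟶ x')
  right : ∀ {x y x' y' : Obj} {m : Pro x y} {n : Pro x' y'}, Cell m n → (y ⟶ y')
  -- the category of proarrows and cells, and functoriality of source and target
  idc : ∀ {x y : Obj} (m : Pro x y), Cell m m
  vcomp : ∀ {x y x' y' x'' y'' : Obj} {m : Pro x y} {m' : Pro x' y'} {m'' : Pro x'' y''},
    Cell m m' → Cell m' m'' → Cell m m''
  left_idc : ∀ {x y : Obj} (m : Pro x y), left (idc m) = 𝟙 x
  right_idc : ∀ {x y : Obj} (m : Pro x y), right (idc m) = 𝟙 y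
  left_vcomp : ∀ {x y x' y' x'' y'' : Obj} {m : Pro x y} {m' : Pro x' y'} {m'' : Pro x'' y''}
    (α : Cell m m') (β : Cell m' m''), left (vcomp α β) = left α ≫ left β
  right_vcomp : ∀ {x y x' y' x'' y'' : Obj} {m : Pro x y} {m' : Pro x' y'} {m'' : Pro x'' y''}
    (α : Cell m m') (β : Cell m' m''), right (vcomp α β) = right α ≫ right β
  id_vcomp : ∀ {x y x' y' : Obj} {m : Pro x y} {m' : Pro x' y'} (α : Cell m m'),
    vcomp (idc m) α = α
  vcomp_id : ∀ {x y x' y' : Obj} {m : Pro x y} {m' : Pro x' y'} (α : Cell m m'),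
    vcomp α (idc m') = α
  vcomp_assoc : ∀ {x y x' y' x'' y'' x''' y''' : Obj} {m : Pro x y} {m' : Pro x' y'}
    {m'' : Pro x'' y''} {m''' : Pro x''' y'''} (α : Cell m m') (β : Cell m' m'')
    (γ : Cell m'' m'''), vcomp (vcomp α β) γ = vcomp α (vcomp β γ)
  -- external composition
  comp : ∀ {x y z : Obj}, Pro x y → Pro y z → Pro x z
  hcomp : ∀ {x y z x' y' z' : Obj} {m : Pro x y} {n : Pro y z} {m' : Pro x' y'} {n' : Pro y' z'}
    (α : Cell m m') (β : Cell n n'), right α = left β → Cell (comp m n) (comp m' n')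
  left_hcomp : ∀ {x y z x' y' z' : Obj} {m : Pro x y} {n : Pro y z} {m' : Pro x' y'}
    {n' : Pro y' z'} (α : Cell m m') (β : Cell n n') (h : right α = left β),
    left (hcomp α β h) = left α
  right_hcomp : ∀ {x y z x' y' z' : Obj} {m : Pro x y} {n : Pro y z} {m' : Pro x' y'}
    {n' : Pro y' z'} (α : Cell m m') (β : Cell n n') (h : right α = left β),
    right (hcomp α β h) = right β
  hcomp_idc : ∀ {x y z : Obj} (m : Pro x y) (n : Pro y z),
    hcomp (idc m) (idc n) ((right_idc m).trans (left_idc n).symm) = idc (comp m n)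
  hcomp_vcomp : ∀ {x y z x' y' z' x'' y'' z'' : Obj} {m : Pro x y} {n : Pro y z} {m' : Pro x' y'}
    {n' : Pro y' z'} {m'' : Pro x'' y''} {n'' : Pro y'' z''}
    (α : Cell m m') (β : Cell n n') (α' : Cell m' m'') (β' : Cell n' n'')
    (h : right α = left β) (h' : right α' = left β'),
    hcomp (vcomp α α') (vcomp β β') (by rw [right_vcomp, left_vcomp, h, h'])
      = vcomp (hcomp α β h) (hcomp α' β' h')
  -- external identities
  unit : ∀ x : Obj, Pro x x
  hid : ∀ {x x' : Obj}, (x ⟶ x') → Cell (unit x) (unit x')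
  left_hid : ∀ {x x' : Obj} (f : x ⟶ x'), left (hid f) = f
  right_hid : ∀ {x x' : Obj} (f : x ⟶ x'), right (hid f) = f
  hid_id : ∀ x : Obj, hid (𝟙 x) = idc (unit x)
  hid_comp : ∀ {x x' x'' : Obj} (f : x ⟶ x') (g : x' ⟶ x''),
    hid (f ≫ g) = vcomp (hid f) (hid g)
  -- associators
  assoc : ∀ {x y z p : Obj} (m : Pro x y) (n : Pro y z) (k : Pro z p),
    Cell (comp (comp m n) k) (comp m (comp n k))
  assocInv : ∀ {x y z p : Obj} (m : Pro x y) (n : Pro y z) (k : Pro z p),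
    Cell (comp m (comp n k)) (comp (comp m n) k)
  left_assoc : ∀ {x y z p : Obj} (m : Pro x y) (n : Pro y z) (k : Pro z p),
    left (assoc m n k) = 𝟙 x
  right_assoc : ∀ {x y z p : Obj} (m : Pro x y) (n : Pro y z) (k : Pro z p),
    right (assoc m n k) = 𝟙 p
  assoc_assocInv : ∀ {x y z p : Obj} (m : Pro x y) (n : Pro y z) (k : Pro z p),
    vcomp (assoc m n k) (assocInv m n k) = idc _
  assocInv_assoc : ∀ {x y z p : Obj} (m : Pro x y) (n : Pro y z) (k : Pro z p),
    vcomp (assocInv m n k) (assoc m n k) = idc _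
  assoc_natural : ∀ {x y z p x' y' z' p' : Obj} {m : Pro x y} {n : Pro y z} {k : Pro z p}
    {m' : Pro x' y'} {n' : Pro y' z'} {k' : Pro z' p'}
    (α : Cell m m') (β : Cell n n') (γ : Cell k k') (h : right α = left β)
    (h' : right β = left γ),
    vcomp (hcomp (hcomp α β h) γ ((right_hcomp α β h).trans h')) (assoc m' n' k')
      = vcomp (assoc m n k) (hcomp α (hcomp β γ h') (h.trans (left_hcomp β γ h').symm))
  -- unitors
  lunit : ∀ {x y : Obj} (m : Pro x y), Cell (comp (unit x) m) m
  lunitInv : ∀ {x y : Obj} (m : Pro x y), Cell m (comp (unit x) m)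
  left_lunit : ∀ {x y : Obj} (m : Pro x y), left (lunit m) = 𝟙 x
  right_lunit : ∀ {x y : Obj} (m : Pro x y), right (lunit m) = 𝟙 y
  lunit_lunitInv : ∀ {x y : Obj} (m : Pro x y), vcomp (lunit m) (lunitInv m) = idc _
  lunitInv_lunit : ∀ {x y : Obj} (m : Pro x y), vcomp (lunitInv m) (lunit m) = idc _
  lunit_natural : ∀ {x y x' y' : Obj} {m : Pro x y} {m' : Pro x' y'} (α : Cell m m'),
    vcomp (hcomp (hid (left α)) α (right_hid (left α))) (lunit m') = vcomp (lunit m) α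
  runit : ∀ {x y : Obj} (m : Pro x y), Cell (comp m (unit y)) m
  runitInv : ∀ {x y : Obj} (m : Pro x y), Cell m (comp m (unit y))
  left_runit : ∀ {x y : Obj} (m : Pro x y), left (runit m) = 𝟙 x
  right_runit : ∀ {x y : Obj} (m : Pro x y), right (runit m) = 𝟙 y
  runit_runitInv : ∀ {x y : Obj} (m : Pro x y), vcomp (runit m) (runitInv m) = idc _
  runitInv_runit : ∀ {x y : Obj} (m : Pro x y), vcomp (runitInv m) (runit m) = idc _
  runit_natural : ∀ {x y x' y' : Obj} {m : Pro x y} {m' : Pro x' y'} (α : Cell m m'),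
    vcomp (hcomp α (hid (right α)) (left_hid (right α)).symm) (runit m') = vcomp (runit m) α
  -- coherence
  pentagon : ∀ {x y z p q : Obj} (m : Pro x y) (n : Pro y z) (k : Pro z p) (l : Pro p q),
    vcomp (hcomp (assoc m n k) (idc l) ((right_assoc m n k).trans (left_idc l).symm))
      (vcomp (assoc m (comp n k) l)
        (hcomp (idc m) (assoc n k l) ((right_idc m).trans (left_assoc n k l).symm)))
      = vcomp (assoc (comp m n) k l) (assoc m n (comp k l))
  triangle : ∀ {x y z : Obj} (m : Pro x y) (n : Pro y z),
    vcomp (assoc m (unit y) n)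
      (hcomp (idc m) (lunit n) ((right_idc m).trans (left_lunit n).symm))
      = hcomp (runit m) (idc n) ((right_runit m).trans (left_idc n).symm)

attribute [instance] DblCat.cat
attribute [simp] DblCat.left_idc DblCat.right_idc DblCat.left_vcomp DblCat.right_vcomp
  DblCat.id_vcomp DblCat.vcomp_id DblCat.vcomp_assoc DblCat.left_hcomp DblCat.right_hcomp
  DblCat.hcomp_idc DblCat.left_hid DblCat.right_hid DblCat.hid_id DblCat.left_assoc
  DblCat.right_assoc DblCat.assoc_assocInv DblCat.assocInv_assoc DblCat.left_lunit
  DblCat.right_lunit DblCat.lunit_lunitInv DblCat.lunitInv_lunit DblCat.left_runit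
  DblCat.right_runit DblCat.runit_runitInv DblCat.runitInv_runit

namespace DblCat

variable (D : DblCat.{v₁, v₂, u₁, u₂})

theorem left_inv_of_left {x y : D.Obj} {m n : D.Pro x y} (α : D.Cell m n) (β : D.Cell n m)
    (h : D.vcomp α β = D.idc m) (hα : D.left α = 𝟙 x) : D.left β = 𝟙 x := by
  have := congrArg D.left h
  simpa [hα] using this

theorem right_inv_of_right {x y : D.Obj} {m n : D.Pro x y} (α : D.Cell m n) (β : D.Cell n m)
    (h : D.vcomp α β = D.idc m) (hα : D.right α = 𝟙 y) : D.right β = 𝟙 y := by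
  have := congrArg D.right h
  simpa [hα] using this

end DblCat

/-- A cell is an isomorphism if it is invertible in the category of proarrows and cells. -/
def DblCat.IsIsoCell (D : DblCat.{v₁, v₂, u₁, u₂}) {x y x' y' : D.Obj} {m : D.Pro x y}
    {n : D.Pro x' y'} (α : D.Cell m n) : Prop :=
  ∃ β : D.Cell n m, D.vcomp α β = D.idc m ∧ D.vcomp β α = D.idc n

/-- A lax double functor. -/
structure LaxDblFunctor (D : DblCat.{v₁, v₂, u₁, u₂}) (E : DblCat.{v₃, v₄, u₃, u₄}) where
  obj : D.Obj → E.Obj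
  map : ∀ {x x' : D.Obj}, (x ⟶ x') → (obj x ⟶ obj x')
  map_id : ∀ x : D.Obj, map (𝟙 x) = 𝟙 (obj x)
  map_comp : ∀ {x x' x'' : D.Obj} (f : x ⟶ x') (g : x' ⟶ x''), map (f ≫ g) = map f ≫ map g
  pro : ∀ {x y : D.Obj}, D.Pro x y → E.Pro (obj x) (obj y)
  cell : ∀ {x y x' y' : D.Obj} {m : D.Pro x y} {n : D.Pro x' y'},
    D.Cell m n → E.Cell (pro m) (pro n)
  left_cell : ∀ {x y x' y' : D.Obj} {m : D.Pro x y} {n : D.Pro x' y'} (α : D.Cell m n),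
    E.left (cell α) = map (D.left α)
  right_cell : ∀ {x y x' y' : D.Obj} {m : D.Pro x y} {n : D.Pro x' y'} (α : D.Cell m n),
    E.right (cell α) = map (D.right α)
  cell_idc : ∀ {x y : D.Obj} (m : D.Pro x y), cell (D.idc m) = E.idc (pro m)
  cell_vcomp : ∀ {x y x' y' x'' y'' : D.Obj} {m : D.Pro x y} {m' : D.Pro x' y'}
    {m'' : D.Pro x'' y''} (α : D.Cell m m') (β : D.Cell m' m''),
    cell (D.vcomp α β) = E.vcomp (cell α) (cell β)
  /-- The composition comparison cells. -/
  laxator : ∀ {x y z : D.Obj} (m : D.Pro x y) (n : D.Pro y z),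
    E.Cell (E.comp (pro m) (pro n)) (pro (D.comp m n))
  left_laxator : ∀ {x y z : D.Obj} (m : D.Pro x y) (n : D.Pro y z),
    E.left (laxator m n) = 𝟙 (obj x)
  right_laxator : ∀ {x y z : D.Obj} (m : D.Pro x y) (n : D.Pro y z),
    E.right (laxator m n) = 𝟙 (obj z)
  laxator_natural : ∀ {x y z x' y' z' : D.Obj} {m : D.Pro x y} {n : D.Pro y z}
    {m' : D.Pro x' y'} {n' : D.Pro y' z'} (α : D.Cell m m') (β : D.Cell n n')
    (h : D.right α = D.left β),
    E.vcomp (E.hcomp (cell α) (cell β) (by rw [right_cell, left_cell, h])) (laxator m' n')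
      = E.vcomp (laxator m n) (cell (D.hcomp α β h))
  /-- The identity comparison cells. -/
  unitor : ∀ x : D.Obj, E.Cell (E.unit (obj x)) (pro (D.unit x))
  left_unitor : ∀ x : D.Obj, E.left (unitor x) = 𝟙 (obj x)
  right_unitor : ∀ x : D.Obj, E.right (unitor x) = 𝟙 (obj x)
  unitor_natural : ∀ {x x' : D.Obj} (f : x ⟶ x'),
    E.vcomp (E.hid (map f)) (unitor x') = E.vcomp (unitor x) (cell (D.hid f))
  associativity : ∀ {x y z p : D.Obj} (m : D.Pro x y) (n : D.Pro y z) (k : D.Pro z p),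
    E.vcomp (E.hcomp (laxator m n) (E.idc (pro k))
        ((right_laxator m n).trans (E.left_idc _).symm))
      (E.vcomp (laxator (D.comp m n) k) (cell (D.assoc m n k)))
      = E.vcomp (E.assoc (pro m) (pro n) (pro k))
        (E.vcomp (E.hcomp (E.idc (pro m)) (laxator n k)
          ((E.right_idc _).trans (left_laxator n k).symm)) (laxator m (D.comp n k)))
  left_unitality : ∀ {x y : D.Obj} (m : D.Pro x y),
    E.vcomp (E.hcomp (unitor x) (E.idc (pro m)) ((right_unitor x).trans (E.left_idc _).symm))
      (E.vcomp (laxator (D.unit x) m) (cell (D.lunit m))) = E.lunit (pro m)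
  right_unitality : ∀ {x y : D.Obj} (m : D.Pro x y),
    E.vcomp (E.hcomp (E.idc (pro m)) (unitor y) ((E.right_idc _).trans (left_unitor y).symm))
      (E.vcomp (laxator m (D.unit y)) (cell (D.runit m))) = E.runit (pro m)

attribute [simp] LaxDblFunctor.map_id LaxDblFunctor.map_comp LaxDblFunctor.left_cell
  LaxDblFunctor.right_cell LaxDblFunctor.cell_idc LaxDblFunctor.cell_vcomp
  LaxDblFunctor.left_laxator LaxDblFunctor.right_laxator LaxDblFunctor.left_unitor
  LaxDblFunctor.right_unitor

namespace LaxDblFunctor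

/-- The identity double functor. -/
@[simps]
def id (D : DblCat.{v₁, v₂, u₁, u₂}) : LaxDblFunctor D D where
  obj x := x
  map f := f
  map_id _ := rfl
  map_comp _ _ := rfl
  pro m := m
  cell α := α
  left_cell _ := rfl
  right_cell _ := rfl
  cell_idc _ := rfl
  cell_vcomp _ _ := rfl
  laxator m n := D.idc _
  left_laxator _ _ := D.left_idc _
  right_laxator _ _ := D.right_idc _
  laxator_natural _ _ _ := by simp
  unitor x := D.idc _
  left_unitor _ := D.left_idc _
  right_unitor _ := D.right_idc _
  unitor_natural _ := by simp
  associativity _ _ _ := by simp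
  left_unitality _ := by simp
  right_unitality _ := by simp

/-- The composite of lax double functors, in diagrammatic order. -/
@[simps]
def comp {D : DblCat.{v₁, v₂, u₁, u₂}} {E : DblCat.{v₃, v₄, u₃, u₄}}
    {K : DblCat.{v₅, v₆, u₅, u₆}} (F : LaxDblFunctor D E) (G : LaxDblFunctor E K) :
    LaxDblFunctor D K where
  obj x := G.obj (F.obj x)
  map f := G.map (F.map f)
  map_id _ := by simp
  map_comp _ _ := by simp
  pro m := G.pro (F.pro m)
  cell α := G.cell (F.cell α)
  left_cell _ := by simp
  right_cell _ := by simp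
  cell_idc _ := by simp
  cell_vcomp _ _ := by simp
  laxator m n := K.vcomp (G.laxator (F.pro m) (F.pro n)) (G.cell (F.laxator m n))
  left_laxator _ _ := by simp
  right_laxator _ _ := by simp
  laxator_natural α β h := by
    rw [← K.vcomp_assoc, G.laxator_natural (F.cell α) (F.cell β) (by simp [h]), K.vcomp_assoc,
      ← G.cell_vcomp, F.laxator_natural, G.cell_vcomp, K.vcomp_assoc]
  unitor x := K.vcomp (G.unitor (F.obj x)) (G.cell (F.unitor x))
  left_unitor _ := by simp
  right_unitor _ := by simp
  unitor_natural f := by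
    rw [← K.vcomp_assoc, G.unitor_natural, K.vcomp_assoc, ← G.cell_vcomp, F.unitor_natural,
      G.cell_vcomp, K.vcomp_assoc]
  associativity m n k := by
    have e₁ := K.hcomp_vcomp (G.laxator (F.pro m) (F.pro n)) (K.idc (G.pro (F.pro k)))
      (G.cell (F.laxator m n)) (G.cell (E.idc (F.pro k))) (by simp) (by simp)
    have e₂ := K.hcomp_vcomp (K.idc (G.pro (F.pro m))) (G.laxator (F.pro n) (F.pro k))
      (G.cell (E.idc (F.pro m))) (G.cell (F.laxator n k)) (by simp) (by simp)
    have e₃ := G.laxator_natural (F.laxator m n) (E.idc (F.pro k)) (by simp)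
    have e₄ := G.laxator_natural (E.idc (F.pro m)) (F.laxator n k) (by simp)
    have e₅ := congrArg G.cell (F.associativity m n k)
    have e₆ := G.associativity (F.pro m) (F.pro n) (F.pro k)
    simp only [G.cell_vcomp] at e₅
    simp only [G.cell_idc, K.vcomp_id] at e₁ e₂
    rw [e₁, e₂]
    simp only [K.vcomp_assoc]
    simp only [G.cell_idc] at e₃ e₄
    rw [← K.vcomp_assoc (K.hcomp (G.cell (F.laxator m n)) _ _), e₃,
      ← K.vcomp_assoc (K.hcomp _ (G.cell (F.laxator n k)) _), e₄]
    simp only [K.vcomp_assoc]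
    rw [e₅, ← K.vcomp_assoc (G.laxator _ _), ← K.vcomp_assoc (K.hcomp _ _ _), e₆]
    simp only [K.vcomp_assoc]
  left_unitality {x y} m := by
    have e₁ := K.hcomp_vcomp (G.unitor (F.obj x)) (K.idc (G.pro (F.pro m)))
      (G.cell (F.unitor x)) (G.cell (E.idc (F.pro m))) (by simp) (by simp)
    have e₃ := G.laxator_natural (F.unitor x) (E.idc (F.pro m)) (by simp)
    have e₅ := congrArg G.cell (F.left_unitality m)
    have e₆ := G.left_unitality (F.pro m)
    simp only [G.cell_vcomp] at e₅
    simp only [G.cell_idc, K.vcomp_id] at e₁ e₃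
    rw [e₁]
    simp only [K.vcomp_assoc]
    rw [← K.vcomp_assoc (K.hcomp (G.cell (F.unitor x)) _ _), e₃]
    simp only [K.vcomp_assoc]
    rw [e₅, e₆]
  right_unitality {x y} m := by
    have e₁ := K.hcomp_vcomp (K.idc (G.pro (F.pro m))) (G.unitor (F.obj y))
      (G.cell (E.idc (F.pro m))) (G.cell (F.unitor y)) (by simp) (by simp)
    have e₃ := G.laxator_natural (E.idc (F.pro m)) (F.unitor y) (by simp)
    have e₅ := congrArg G.cell (F.right_unitality m)
    have e₆ := G.right_unitality (F.pro m)
    simp only [G.cell_vcomp] at e₅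
    simp only [G.cell_idc, K.vcomp_id] at e₁ e₃
    rw [e₁]
    simp only [K.vcomp_assoc]
    rw [← K.vcomp_assoc (K.hcomp _ (G.cell (F.unitor y)) _), e₃]
    simp only [K.vcomp_assoc]
    rw [e₅, e₆]

end LaxDblFunctor

/-- A natural transformation of lax double functors. -/
structure DblNatTrans {D : DblCat.{v₁, v₂, u₁, u₂}} {E : DblCat.{v₃, v₄, u₃, u₄}}
    (F G : LaxDblFunctor D E) where
  app : ∀ x : D.Obj, F.obj x ⟶ G.obj x
  naturality : ∀ {x x' : D.Obj} (f : x ⟶ x'), F.map f ≫ app x' = app x ≫ G.map f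
  cellApp : ∀ {x y : D.Obj} (m : D.Pro x y), E.Cell (F.pro m) (G.pro m)
  left_cellApp : ∀ {x y : D.Obj} (m : D.Pro x y), E.left (cellApp m) = app x
  right_cellApp : ∀ {x y : D.Obj} (m : D.Pro x y), E.right (cellApp m) = app y
  cell_naturality : ∀ {x y x' y' : D.Obj} {m : D.Pro x y} {m' : D.Pro x' y'} (α : D.Cell m m'),
    E.vcomp (F.cell α) (cellApp m') = E.vcomp (cellApp m) (G.cell α)
  comp_compat : ∀ {x y z : D.Obj} (m : D.Pro x y) (n : D.Pro y z),
    E.vcomp (F.laxator m n) (cellApp (D.comp m n))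
      = E.vcomp (E.hcomp (cellApp m) (cellApp n)
          ((right_cellApp m).trans (left_cellApp n).symm)) (G.laxator m n)
  unit_compat : ∀ x : D.Obj,
    E.vcomp (F.unitor x) (cellApp (D.unit x)) = E.vcomp (E.hid (app x)) (G.unitor x)

/-- An adjunction `L ⊣ R` in the 2-category of double categories, lax double functors
and natural transformations. -/
structure LaxDblAdjunction {D : DblCat.{v₁, v₂, u₁, u₂}} {E : DblCat.{v₃, v₄, u₃, u₄}}
    (L : LaxDblFunctor D E) (R : LaxDblFunctor E D) where
  unit : DblNatTrans (LaxDblFunctor.id D) (L.comp R)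
  counit : DblNatTrans (R.comp L) (LaxDblFunctor.id E)
  left_triangle : ∀ x : D.Obj, L.map (unit.app x) ≫ counit.app (L.obj x) = 𝟙 (L.obj x)
  left_triangle_cell : ∀ {x y : D.Obj} (m : D.Pro x y),
    E.vcomp (L.cell (unit.cellApp m)) (counit.cellApp (L.pro m)) = E.idc (L.pro m)
  right_triangle : ∀ x : E.Obj, unit.app (R.obj x) ≫ R.map (counit.app x) = 𝟙 (R.obj x)
  right_triangle_cell : ∀ {x y : E.Obj} (m : E.Pro x y),
    D.vcomp (unit.cellApp (R.pro m)) (R.cell (counit.cellApp m)) = D.idc (R.pro m)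

/-! ### Contravariant finite families -/

namespace FinFamOp

variable {D : DblCat.{v₁, v₂, u₁, u₂}}

/-- A finite family of objects `(I, x)` of a double category. -/
structure Fam (D : DblCat.{v₁, v₂, u₁, u₂}) where
  I : Type t
  [fin : Finite I]
  x : I → D.Obj

attribute [instance] Fam.fin

/-- An arrow `(I, x) ⟶ (J, y)`: a function `f₀ : J → I` with arrows `f_j : x_{f₀ j} ⟶ y_j`. -/
@[ext]
structure Hom (X Y : Fam.{t} D) where
  ix : Y.I → X.I
  hom : ∀ j : Y.I, X.x (ix j) ⟶ Y.x j

@[simps]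
instance : Category (Fam.{t} D) where
  Hom := Hom
  id X := ⟨fun i => i, fun i => 𝟙 (X.x i)⟩
  comp f g := ⟨fun k => f.ix (g.ix k), fun k => f.hom (g.ix k) ≫ g.hom k⟩
  id_comp f := by cases f; simp
  comp_id f := by cases f; simp
  assoc f g h := by simp

/-- A proarrow `(I, x) ⇸ (J, y)`: a span `I ←l- A -r→ J` of finite sets, with a proarrow
`m_a : x_i ⇸ y_j` for each `a : i ⇸ j`, that is, each `a ∈ A` with `l a = i` and `r a = j`. -/
structure Pro (X Y : Fam.{t} D) where
  A : Type t
  [fin : Finite A]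
  l : A → X.I
  r : A → Y.I
  m : ∀ (a : A) {i : X.I} {j : Y.I}, l a = i → r a = j → D.Pro (X.x i) (Y.x j)

attribute [instance] Pro.fin

/-- A cell from `(A, m)` to `(B, n)`: a map of spans in the reverse direction, with a
cell `α_b : m_{α₀ b} ⟶ n_b` bounded by `f_k` and `g_l` for each `b : k ⇸ l`. -/
structure Cell {X Y X' Y' : Fam.{t} D} (M : Pro X Y) (N : Pro X' Y') where
  left : X ⟶ X'
  right : Y ⟶ Y'
  ix : N.A → M.A
  ix_l : ∀ b, M.l (ix b) = left.ix (N.l b)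
  ix_r : ∀ b, M.r (ix b) = right.ix (N.r b)
  cell : ∀ (b : N.A) {k : X'.I} {l : Y'.I} (hk : N.l b = k) (hl : N.r b = l),
    D.Cell (M.m (ix b) ((ix_l b).trans (congrArg left.ix hk))
      ((ix_r b).trans (congrArg right.ix hl))) (N.m b hk hl)
  left_cell : ∀ (b : N.A) {k : X'.I} {l : Y'.I} (hk : N.l b = k) (hl : N.r b = l),
    D.left (cell b hk hl) = left.hom k
  right_cell : ∀ (b : N.A) {k : X'.I} {l : Y'.I} (hk : N.l b = k) (hl : N.r b = l),
    D.right (cell b hk hl) = right.hom l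

attribute [simp] Cell.left_cell Cell.right_cell

theorem Cell.ext' {X Y X' Y' : Fam.{t} D} {M : Pro X Y} {N : Pro X' Y'} {α β : Cell M N}
    (hl : α.left = β.left) (hr : α.right = β.right) (hix : ∀ b, α.ix b = β.ix b)
    (hc : ∀ b, HEq (α.cell b rfl rfl) (β.cell b rfl rfl)) : α = β := by
  obtain ⟨l, r, ix, a, b, c, d, e⟩ := α
  obtain ⟨l', r', ix', a', b', c', d', e'⟩ := β
  obtain rfl : l = l' := hl
  obtain rfl : r = r' := hr
  obtain rfl : ix = ix' := funext hix
  obtain rfl : @c = @c' := by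
    funext x k l hk hl
    subst hk hl
    exact eq_of_heq (hc x)
  rfl

/-- The identity cell. -/
def idCell {X Y : Fam.{t} D} (M : Pro X Y) : Cell M M where
  left := 𝟙 X
  right := 𝟙 Y
  ix b := b
  ix_l _ := rfl
  ix_r _ := rfl
  cell b _ _ hk hl := D.idc (M.m b hk hl)
  left_cell _ := by intros; simp
  right_cell _ := by intros; simp

/-- The composite of cells in the category of proarrows and cells. -/
def vcomp {X Y X' Y' X'' Y'' : Fam.{t} D} {M : Pro X Y} {M' : Pro X' Y'} {M'' : Pro X'' Y''}
    (α : Cell M M') (β : Cell M' M'') : Cell M M'' where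
  left := α.left ≫ β.left
  right := α.right ≫ β.right
  ix b := α.ix (β.ix b)
  ix_l b := (α.ix_l _).trans (congrArg α.left.ix (β.ix_l b))
  ix_r b := (α.ix_r _).trans (congrArg α.right.ix (β.ix_r b))
  cell b _ _ hk hl := D.vcomp (α.cell (β.ix b) _ _) (β.cell b hk hl)
  left_cell _ := by intros; simp
  right_cell _ := by intros; simp

/-- The apex `A ×_J B` of a composite of spans, with its projection to `J`: an element is a
composable pair `i -a→ j -b→ k`. -/
@[ext]
structure Pullback {X Y Z : Fam.{t} D} (M : Pro X Y) (N : Pro Y Z) : Type t where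
  fst : M.A
  mid : Y.I
  snd : N.A
  hr : M.r fst = mid
  hl : N.l snd = mid

instance {X Y Z : Fam.{t} D} (M : Pro X Y) (N : Pro Y Z) : Finite (Pullback M N) :=
  Finite.of_injective (fun p => (p.fst, p.snd)) fun p q h => by
    obtain ⟨a, j, b, rfl, hl⟩ := p
    obtain ⟨a', j', b', rfl, hl'⟩ := q
    obtain ⟨rfl, rfl⟩ := Prod.mk.inj h
    rfl

/-- Composition of proarrows: spans are composed by pullback and proarrows componentwise. -/
def comp {X Y Z : Fam.{t} D} (M : Pro X Y) (N : Pro Y Z) : Pro X Z where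
  A := Pullback M N
  l p := M.l p.fst
  r p := N.r p.snd
  m p _ _ hi hj := D.comp (M.m p.fst hi p.hr) (N.m p.snd p.hl hj)

/-- The components of a cell with its left boundary replaced by an equal arrow. -/
def Cell.cellOf {X Y X' Y' : Fam.{t} D} {M : Pro X Y} {N : Pro X' Y'} (α : Cell M N)
    {g : X ⟶ X'} (h : g = α.left) (b : N.A) {k : X'.I} {l : Y'.I} (hk : N.l b = k)
    (hl : N.r b = l) :
    D.Cell (M.m (α.ix b) ((α.ix_l b).trans ((congrArg α.left.ix hk).trans (by rw [h])) :
      M.l (α.ix b) = g.ix k) ((α.ix_r b).trans (congrArg α.right.ix hl))) (N.m b hk hl) := by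
  subst h
  exact α.cell b hk hl

theorem Cell.left_cellOf {X Y X' Y' : Fam.{t} D} {M : Pro X Y} {N : Pro X' Y'} (α : Cell M N)
    {g : X ⟶ X'} (h : g = α.left) (b : N.A) {k : X'.I} {l : Y'.I} (hk : N.l b = k)
    (hl : N.r b = l) : D.left (α.cellOf h b hk hl) = g.hom k := by
  subst h
  exact α.left_cell b hk hl

theorem Cell.right_cellOf {X Y X' Y' : Fam.{t} D} {M : Pro X Y} {N : Pro X' Y'} (α : Cell M N)
    {g : X ⟶ X'} (h : g = α.left) (b : N.A) {k : X'.I} {l : Y'.I} (hk : N.l b = k)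
    (hl : N.r b = l) : D.right (α.cellOf h b hk hl) = α.right.hom l := by
  subst h
  exact α.right_cell b hk hl

theorem Cell.cellOf_heq {X Y X' Y' : Fam.{t} D} {M : Pro X Y} {N : Pro X' Y'} (α : Cell M N)
    {g : X ⟶ X'} (h : g = α.left) (b : N.A) {k : X'.I} {l : Y'.I} (hk : N.l b = k)
    (hl : N.r b = l) : HEq (α.cellOf h b hk hl) (α.cell b hk hl) := by
  subst h
  exact HEq.rfl

/-- The external composite of cells. -/
def hcomp {X Y Z X' Y' Z' : Fam.{t} D} {M : Pro X Y} {N : Pro Y Z} {M' : Pro X' Y'}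
    {N' : Pro Y' Z'} (α : Cell M M') (β : Cell N N') (h : α.right = β.left) :
    Cell (comp M N) (comp M' N') where
  left := α.left
  right := β.right
  ix p := ⟨α.ix p.fst, α.right.ix p.mid, β.ix p.snd, (α.ix_r _).trans (congrArg _ p.hr),
    (β.ix_l _).trans ((congrArg β.left.ix p.hl).trans (by rw [h]))⟩
  ix_l p := α.ix_l _
  ix_r p := β.ix_r _
  cell p _ _ hi hj := D.hcomp (α.cell p.fst hi p.hr) (β.cellOf h p.snd p.hl hj)
    ((α.right_cell _ _ _).trans (β.left_cellOf _ _ _ _).symm)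
  left_cell p _ _ hi hj := (D.left_hcomp _ _ _).trans (α.left_cell _ _ _)
  right_cell p _ _ hi hj := (D.right_hcomp _ _ _).trans (β.right_cellOf _ _ _ _)

/-- The identity proarrow, indexed by the identity span, with components the identities
`id_{x_i} : x_i ⇸ x_i`. -/
def unit (X : Fam.{t} D) : Pro X X where
  A := X.I
  l i := i
  r i := i
  m _ _ _ hi hj := hj ▸ hi ▸ D.unit _

def hidCell {X X' : Fam.{t} D} (f : X ⟶ X') (b : X'.I) {k l : X'.I} (hk : b = k) (hl : b = l) :
    D.Cell ((unit X).m (f.ix b) (congrArg f.ix hk) (congrArg f.ix hl)) ((unit X').m b hk hl) := by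
  subst hk hl
  exact D.hid (f.hom _)

/-- The identity cell on an arrow, with components the identity cells of `D`. -/
def hid {X X' : Fam.{t} D} (f : X ⟶ X') : Cell (unit X) (unit X') where
  left := f
  right := f
  ix := f.ix
  ix_l _ := rfl
  ix_r _ := rfl
  cell b _ _ hk hl := hidCell f b hk hl
  left_cell b _ _ hk hl := by
    change b = _ at hk; change b = _ at hl; subst hk hl; exact D.left_hid _
  right_cell b _ _ hk hl := by
    change b = _ at hk; change b = _ at hl; subst hk hl; exact D.right_hid _

def assoc {X Y Z W : Fam.{t} D} (M : Pro X Y) (N : Pro Y Z) (K : Pro Z W) :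
    Cell (comp (comp M N) K) (comp M (comp N K)) where
  left := 𝟙 X
  right := 𝟙 W
  ix p := ⟨⟨p.fst, p.mid, p.snd.fst, p.hr, p.hl⟩, p.snd.mid, p.snd.snd, p.snd.hr, p.snd.hl⟩
  ix_l _ := rfl
  ix_r _ := rfl
  cell p _ _ hi hj := D.assoc (M.m p.fst hi p.hr) (N.m p.snd.fst p.hl p.snd.hr)
    (K.m p.snd.snd p.snd.hl hj)
  left_cell _ _ _ _ _ := D.left_assoc _ _ _
  right_cell _ _ _ _ _ := D.right_assoc _ _ _

def assocInv {X Y Z W : Fam.{t} D} (M : Pro X Y) (N : Pro Y Z) (K : Pro Z W) :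
    Cell (comp M (comp N K)) (comp (comp M N) K) where
  left := 𝟙 X
  right := 𝟙 W
  ix p := ⟨p.fst.fst, p.fst.mid, ⟨p.fst.snd, p.mid, p.snd, p.hr, p.hl⟩, p.fst.hr, p.fst.hl⟩
  ix_l _ := rfl
  ix_r _ := rfl
  cell p _ _ hi hj := D.assocInv (M.m p.fst.fst hi p.fst.hr) (N.m p.fst.snd p.fst.hl p.hr)
    (K.m p.snd p.hl hj)
  left_cell _ _ _ _ _ := D.left_inv_of_left _ _ (D.assoc_assocInv _ _ _) (D.left_assoc _ _ _)
  right_cell _ _ _ _ _ := D.right_inv_of_right _ _ (D.assoc_assocInv _ _ _) (D.right_assoc _ _ _)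

/-- The component of the left unitor at an element `a : i ⇸ j`. -/
def lunitCell {X Y : Fam.{t} D} (M : Pro X Y) (a : M.A) {i₀ i : X.I} {j : Y.I} (h : i₀ = i)
    (hi : M.l a = i₀) (hj : M.r a = j) :
    D.Cell (D.comp ((unit X).m i₀ h rfl) (M.m a hi hj)) (M.m a (hi.trans h) hj) := by
  subst h
  exact D.lunit _

def lunitInvCell {X Y : Fam.{t} D} (M : Pro X Y) (a : M.A) {i₀ i i₁ : X.I} {j : Y.I} (h : i₀ = i)
    (h₁ : i₀ = i₁) (hi : M.l a = i₁) (hj : M.r a = j) :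
    D.Cell (M.m a (hi.trans (h₁.symm.trans h)) hj)
      (D.comp ((unit X).m i₀ h h₁) (M.m a hi hj)) := by
  subst h h₁
  exact D.lunitInv _

def runitCell {X Y : Fam.{t} D} (M : Pro X Y) (a : M.A) {j₀ j : Y.I} {i : X.I} (h : j₀ = j)
    (hi : M.l a = i) (hj : M.r a = j₀) :
    D.Cell (D.comp (M.m a hi hj) ((unit Y).m j₀ rfl h)) (M.m a hi (hj.trans h)) := by
  subst h
  exact D.runit _

def runitInvCell {X Y : Fam.{t} D} (M : Pro X Y) (a : M.A) {j₀ j j₁ : Y.I} {i : X.I} (h : j₀ = j)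
    (h₁ : j₀ = j₁) (hi : M.l a = i) (hj : M.r a = j₁) :
    D.Cell (M.m a hi (hj.trans (h₁.symm.trans h)))
      (D.comp (M.m a hi hj) ((unit Y).m j₀ h₁ h)) := by
  subst h h₁
  exact D.runitInv _

def lunit {X Y : Fam.{t} D} (M : Pro X Y) : Cell (comp (unit X) M) M where
  left := 𝟙 X
  right := 𝟙 Y
  ix a := ⟨M.l a, M.l a, a, rfl, rfl⟩
  ix_l _ := rfl
  ix_r _ := rfl
  cell a _ _ hi hj := lunitCell M a hi rfl hj
  left_cell _ _ _ hi hj := by subst hi hj; exact D.left_lunit _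
  right_cell _ _ _ hi hj := by subst hi hj; exact D.right_lunit _

def lunitInv {X Y : Fam.{t} D} (M : Pro X Y) : Cell M (comp (unit X) M) where
  left := 𝟙 X
  right := 𝟙 Y
  ix p := p.snd
  ix_l p := p.hl.trans p.hr.symm
  ix_r _ := rfl
  cell p _ _ hi hj := lunitInvCell M p.snd hi p.hr p.hl hj
  left_cell p _ _ hi hj := by
    obtain ⟨a, _, b, h, h'⟩ := p
    subst hi hj h'; change a = _ at h; subst h; exact D.left_inv_of_left _ _ (D.lunit_lunitInv _) (D.left_lunit _)
  right_cell p _ _ hi hj := by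
    obtain ⟨a, _, b, h, h'⟩ := p
    subst hi hj h'; change a = _ at h; subst h; exact D.right_inv_of_right _ _ (D.lunit_lunitInv _) (D.right_lunit _)

def runit {X Y : Fam.{t} D} (M : Pro X Y) : Cell (comp M (unit Y)) M where
  left := 𝟙 X
  right := 𝟙 Y
  ix a := ⟨a, M.r a, M.r a, rfl, rfl⟩
  ix_l _ := rfl
  ix_r _ := rfl
  cell a _ _ hi hj := runitCell M a hj hi rfl
  left_cell _ _ _ hi hj := by subst hi hj; exact D.left_runit _
  right_cell _ _ _ hi hj := by subst hi hj; exact D.right_runit _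

def runitInv {X Y : Fam.{t} D} (M : Pro X Y) : Cell M (comp M (unit Y)) where
  left := 𝟙 X
  right := 𝟙 Y
  ix p := p.fst
  ix_l _ := rfl
  ix_r p := p.hr.trans p.hl.symm
  cell p _ _ hi hj := runitInvCell M p.fst hj p.hl hi p.hr
  left_cell p _ _ hi hj := by
    obtain ⟨b, _, a, h', h⟩ := p
    subst hi hj h'; change a = _ at h; subst h; exact D.left_inv_of_left _ _ (D.runit_runitInv _) (D.left_runit _)
  right_cell p _ _ hi hj := by
    obtain ⟨b, _, a, h', h⟩ := p
    subst hi hj h'; change a = _ at h; subst h; exact D.right_inv_of_right _ _ (D.runit_runitInv _) (D.right_runit _)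

theorem lunit_natural {X Y X' Y' : Fam.{t} D} {M : Pro X Y} {M' : Pro X' Y'} (α : Cell M M') :
    vcomp (hcomp (hid α.left) α rfl) (lunit M') = vcomp (lunit M) α := by
  have key : ∀ (a : M.A) (b : M'.A) {i : X.I} {j : Y.I} {i' : X'.I} {j' : Y'.I}
      (hi : M.l a = i) (hj : M.r a = j) (hi' : M'.l b = i') (hj' : M'.r b = j')
      (γ : D.Cell (M.m a hi hj) (M'.m b hi' hj')) (f : X.x i ⟶ X'.x i') (h : D.left γ = f),
      HEq (D.vcomp (D.hcomp (D.hid f) γ (by simp [h])) (D.lunit (M'.m b hi' hj')))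
        (D.vcomp (lunitCell M a hi rfl hj) γ) := by
    intro a b i j i' j' hi hj hi' hj' γ f h
    subst hi h
    exact heq_of_eq (D.lunit_natural γ)
  refine Cell.ext' ?_ ?_ ?_ ?_
  · exact (Category.comp_id _).trans (Category.id_comp _).symm
  · exact (Category.comp_id _).trans (Category.id_comp _).symm
  · intro b
    have := α.ix_l b
    refine Pullback.ext this.symm this.symm rfl
  · intro b
    exact key _ _ _ _ _ _ _ _ (α.left_cell b rfl rfl)

theorem runit_natural {X Y X' Y' : Fam.{t} D} {M : Pro X Y} {M' : Pro X' Y'} (α : Cell M M') :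
    vcomp (hcomp α (hid α.right) rfl) (runit M') = vcomp (runit M) α := by
  have key : ∀ (a : M.A) (b : M'.A) {i : X.I} {j : Y.I} {i' : X'.I} {j' : Y'.I}
      (hi : M.l a = i) (hj : M.r a = j) (hi' : M'.l b = i') (hj' : M'.r b = j')
      (γ : D.Cell (M.m a hi hj) (M'.m b hi' hj')) (f : Y.x j ⟶ Y'.x j') (h : D.right γ = f),
      HEq (D.vcomp (D.hcomp γ (D.hid f) (by simp [h])) (D.runit (M'.m b hi' hj')))
        (D.vcomp (runitCell M a hj hi rfl) γ) := by
    intro a b i j i' j' hi hj hi' hj' γ f h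
    subst hj h
    exact heq_of_eq (D.runit_natural γ)
  refine Cell.ext' ?_ ?_ ?_ ?_
  · exact (Category.comp_id _).trans (Category.id_comp _).symm
  · exact (Category.comp_id _).trans (Category.id_comp _).symm
  · intro b
    have := α.ix_r b
    refine Pullback.ext rfl this.symm this.symm
  · intro b
    exact key _ _ _ _ _ _ _ _ (α.right_cell b rfl rfl)

theorem triangle {X Y Z : Fam.{t} D} (M : Pro X Y) (N : Pro Y Z) :
    vcomp (assoc M (unit Y) N) (hcomp (idCell M) (lunit N) rfl)
      = hcomp (runit M) (idCell N) rfl := by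
  have key : ∀ (a : M.A) (b : N.A) {j₀ j : Y.I} (h : j₀ = j) (hr : M.r a = j) (hl : N.l b = j₀),
      HEq (D.vcomp (D.assoc (M.m a rfl hr) ((unit Y).m j₀ h rfl) (N.m b hl rfl))
          (D.hcomp (D.idc (M.m a rfl hr)) (lunitCell N b h hl rfl) (by subst h; exact (D.right_idc _).trans (D.left_lunit _).symm)))
        (D.hcomp (runitCell M a hr rfl rfl) (D.idc (N.m b (hl.trans h) rfl))
          (by subst hr; exact (D.right_runit _).trans (D.left_idc _).symm)) := by
    intro a b j₀ j h hr hl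
    subst hr h
    exact heq_of_eq (D.triangle _ _)
  refine Cell.ext' (Category.id_comp _) (Category.id_comp _) ?_ ?_
  · rintro ⟨a, _, b, rfl, h⟩
    exact Pullback.ext (Pullback.ext rfl rfl h) h rfl
  · rintro ⟨a, j, b, hr, h⟩
    exact key a b h hr rfl

end FinFamOp

/-- The contravariant double category of finite families in a double category `D`. -/
def FinFamOp (D : DblCat.{v₁, v₂, u₁, u₂}) : DblCat where
  Obj := FinFamOp.Fam.{t} D
  Pro := FinFamOp.Pro
  Cell := FinFamOp.Cell
  left := FinFamOp.Cell.left
  right := FinFamOp.Cell.right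
  idc := FinFamOp.idCell
  vcomp := FinFamOp.vcomp
  left_idc _ := rfl
  right_idc _ := rfl
  left_vcomp _ _ := rfl
  right_vcomp _ _ := rfl
  id_vcomp α := FinFamOp.Cell.ext' (Category.id_comp _) (Category.id_comp _) (fun _ => rfl)
    fun _ => heq_of_eq (D.id_vcomp _)
  vcomp_id α := FinFamOp.Cell.ext' (Category.comp_id _) (Category.comp_id _) (fun _ => rfl)
    fun _ => heq_of_eq (D.vcomp_id _)
  vcomp_assoc _ _ _ := FinFamOp.Cell.ext' (Category.assoc _ _ _) (Category.assoc _ _ _)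
    (fun _ => rfl) fun _ => heq_of_eq (D.vcomp_assoc _ _ _)
  comp := FinFamOp.comp
  hcomp := FinFamOp.hcomp
  left_hcomp _ _ _ := rfl
  right_hcomp _ _ _ := rfl
  hcomp_idc _ _ := FinFamOp.Cell.ext' rfl rfl (fun _ => rfl) fun _ => heq_of_eq (D.hcomp_idc _ _)
  hcomp_vcomp α β α' β' h h' := by
    obtain ⟨l, r, ix, a, b, c, d, e⟩ := β
    obtain ⟨l', r', ix', a', b', c', d', e'⟩ := β'
    obtain rfl : α.right = l := h
    obtain rfl : α'.right = l' := h'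
    exact FinFamOp.Cell.ext' rfl rfl (fun _ => rfl) fun _ =>
      heq_of_eq (D.hcomp_vcomp _ _ _ _ _ _)
  unit := FinFamOp.unit
  hid := FinFamOp.hid
  left_hid _ := rfl
  right_hid _ := rfl
  hid_id _ := FinFamOp.Cell.ext' rfl rfl (fun _ => rfl) fun _ => heq_of_eq (D.hid_id _)
  hid_comp _ _ := FinFamOp.Cell.ext' rfl rfl (fun _ => rfl) fun _ => heq_of_eq (D.hid_comp _ _)
  assoc := FinFamOp.assoc
  assocInv := FinFamOp.assocInv
  left_assoc _ _ _ := rfl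
  right_assoc _ _ _ := rfl
  assoc_assocInv _ _ _ := FinFamOp.Cell.ext' (Category.id_comp _) (Category.id_comp _)
    (fun _ => rfl) fun _ => heq_of_eq (D.assoc_assocInv _ _ _)
  assocInv_assoc _ _ _ := FinFamOp.Cell.ext' (Category.id_comp _) (Category.id_comp _)
    (fun _ => rfl) fun _ => heq_of_eq (D.assocInv_assoc _ _ _)
  assoc_natural α β γ h h' := by
    obtain ⟨l, r, ix, a, b, c, d, e⟩ := β
    obtain ⟨l', r', ix', a', b', c', d', e'⟩ := γ
    obtain rfl : α.right = l := h
    obtain rfl : r = l' := h'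
    exact FinFamOp.Cell.ext' ((Category.comp_id _).trans (Category.id_comp _).symm)
      ((Category.comp_id _).trans (Category.id_comp _).symm) (fun _ => rfl) fun _ =>
      heq_of_eq (D.assoc_natural _ _ _ _ _)
  lunit := FinFamOp.lunit
  lunitInv := FinFamOp.lunitInv
  left_lunit _ := rfl
  right_lunit _ := rfl
  lunit_lunitInv M := by
    refine FinFamOp.Cell.ext' (Category.id_comp _) (Category.id_comp _) ?_ ?_
    · rintro ⟨a, _, b, h, rfl⟩
      exact FinFamOp.Pullback.ext h.symm rfl rfl
    · rintro ⟨a, _, b, h, rfl⟩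
      change a = _ at h
      subst h
      exact heq_of_eq (D.lunit_lunitInv _)
  lunitInv_lunit M := FinFamOp.Cell.ext' (Category.id_comp _) (Category.id_comp _)
    (fun _ => rfl) fun _ => heq_of_eq (D.lunitInv_lunit _)
  lunit_natural := FinFamOp.lunit_natural
  runit := FinFamOp.runit
  runitInv := FinFamOp.runitInv
  left_runit _ := rfl
  right_runit _ := rfl
  runit_runitInv M := by
    refine FinFamOp.Cell.ext' (Category.id_comp _) (Category.id_comp _) ?_ ?_
    · rintro ⟨b, _, a, rfl, h⟩
      exact FinFamOp.Pullback.ext rfl rfl h.symm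
    · rintro ⟨b, _, a, rfl, h⟩
      change a = _ at h
      subst h
      exact heq_of_eq (D.runit_runitInv _)
  runitInv_runit M := FinFamOp.Cell.ext' (Category.id_comp _) (Category.id_comp _)
    (fun _ => rfl) fun _ => heq_of_eq (D.runitInv_runit _)
  runit_natural := FinFamOp.runit_natural
  pentagon _ _ _ _ := FinFamOp.Cell.ext' (congrArg (𝟙 _ ≫ ·) (Category.id_comp _))
    (congrArg (𝟙 _ ≫ ·) (Category.id_comp _)) (fun _ => rfl) fun _ => heq_of_eq (D.pentagon _ _ _ _)
  triangle := FinFamOp.triangle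

namespace FinFamOp

variable {D : DblCat.{v₁, v₂, u₁, u₂}}

/-- The singleton family `(1, x)`. -/
def single (x : D.Obj) : Fam.{t} D := ⟨PUnit, fun _ => x⟩

/-- The arrow between singleton families given by `f`. -/
def singleHom {x y : D.Obj} (f : x ⟶ y) : single.{t} x ⟶ single y :=
  ⟨fun _ => PUnit.unit, fun _ => f⟩

/-- The singleton family `(1 ← 1 → 1, m)`. -/
def singlePro {x y : D.Obj} (m : D.Pro x y) : Pro (single.{t} x) (single y) :=
  ⟨PUnit, fun _ => PUnit.unit, fun _ => PUnit.unit, fun _ _ _ _ _ => m⟩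

theorem single_ext {x y x' y' : D.Obj} {M : Pro (single.{t} x) (single y)} {m : D.Pro x' y'}
    {α β : Cell M (singlePro m)} (hix : ∀ b, α.ix b = β.ix b)
    (hc : ∀ b, HEq (α.cell b rfl rfl) (β.cell b rfl rfl)) : α = β := by
  have hix' := funext hix
  refine Cell.ext' ?_ ?_ hix hc
  · refine Hom.ext (funext fun _ => rfl) (heq_of_eq (funext fun b => ?_))
    refine (α.left_cell PUnit.unit rfl rfl).symm.trans (Eq.trans ?_ (β.left_cell PUnit.unit rfl rfl))
    obtain ⟨l, r, ix, _, _, _, _, _⟩ := α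
    obtain ⟨l', r', ix', _, _, _, _, _⟩ := β
    obtain rfl : ix = ix' := hix'
    exact congrArg D.left (eq_of_heq (hc PUnit.unit))
  · refine Hom.ext (funext fun _ => rfl) (heq_of_eq (funext fun b => ?_))
    refine (α.right_cell PUnit.unit rfl rfl).symm.trans
      (Eq.trans ?_ (β.right_cell PUnit.unit rfl rfl))
    obtain ⟨l, r, ix, _, _, _, _, _⟩ := α
    obtain ⟨l', r', ix', _, _, _, _, _⟩ := β
    obtain rfl : ix = ix' := hix'
    exact congrArg D.right (eq_of_heq (hc PUnit.unit))

/-- The cell between singleton families given by `α`. -/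
def singleCell {x y x' y' : D.Obj} {m : D.Pro x y} {m' : D.Pro x' y'} (α : D.Cell m m') :
    Cell (singlePro.{t} m) (singlePro m') where
  left := singleHom (D.left α)
  right := singleHom (D.right α)
  ix _ := PUnit.unit
  ix_l _ := rfl
  ix_r _ := rfl
  cell _ _ _ _ _ := α
  left_cell _ _ _ _ _ := rfl
  right_cell _ _ _ _ _ := rfl

end FinFamOp

/-- The diagonal double functor `Δ`, sending objects and proarrows to singleton families. Its
composition and identity comparisons are given by identity cells. -/
def diagonal (D : DblCat.{v₁, v₂, u₁, u₂}) : LaxDblFunctor D (FinFamOp.{t} D) where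
  obj x := FinFamOp.single x
  map f := FinFamOp.singleHom f
  map_id _ := rfl
  map_comp _ _ := rfl
  pro m := FinFamOp.singlePro m
  cell α := FinFamOp.singleCell α
  left_cell _ := rfl
  right_cell _ := rfl
  cell_idc m := FinFamOp.single_ext (fun _ => rfl) (fun _ => HEq.rfl)
  cell_vcomp α β := FinFamOp.single_ext (fun _ => rfl) (fun _ => HEq.rfl)
  laxator m n :=
    { left := 𝟙 _
      right := 𝟙 _
      ix := fun _ => ⟨PUnit.unit, PUnit.unit, PUnit.unit, rfl, rfl⟩
      ix_l := fun _ => rfl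
      ix_r := fun _ => rfl
      cell := fun _ _ _ _ _ => D.idc (D.comp m n)
      left_cell := fun _ _ _ _ _ => D.left_idc _
      right_cell := fun _ _ _ _ _ => D.right_idc _ }
  left_laxator _ _ := rfl
  right_laxator _ _ := rfl
  laxator_natural {_ _ _ _ _ _ m n m' n'} α β h := by
    refine FinFamOp.single_ext (fun _ => rfl) fun b => heq_of_eq ?_
    refine (D.vcomp_id _).trans (Eq.trans ?_ (D.id_vcomp _).symm)
    have key : ∀ (β' : D.Cell n n') (e : β' = β) (h' : D.right α = D.left β'),
        D.hcomp α β' h' = D.hcomp α β h := by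
      rintro _ rfl _; rfl
    exact key _ (eq_of_heq (FinFamOp.Cell.cellOf_heq (FinFamOp.singleCell β)
      (congrArg FinFamOp.singleHom h) PUnit.unit rfl rfl)) _
  unitor x :=
    { left := 𝟙 _
      right := 𝟙 _
      ix := fun _ => PUnit.unit
      ix_l := fun _ => rfl
      ix_r := fun _ => rfl
      cell := fun _ _ _ _ _ => D.idc (D.unit x)
      left_cell := fun _ _ _ _ _ => D.left_idc _
      right_cell := fun _ _ _ _ _ => D.right_idc _ }
  left_unitor _ := rfl
  right_unitor _ := rfl
  unitor_natural f := FinFamOp.single_ext (fun _ => rfl) fun _ =>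
    heq_of_eq ((D.vcomp_id _).trans (D.id_vcomp _).symm)
  associativity m n k := by
    refine FinFamOp.single_ext (fun _ => rfl) fun b => heq_of_eq ?_
    have : D.vcomp (D.hcomp (D.idc (D.comp m n)) (D.idc k) (by simp))
        (D.vcomp (D.idc _) (D.assoc m n k)) = D.vcomp (D.assoc m n k)
        (D.vcomp (D.hcomp (D.idc m) (D.idc (D.comp n k)) (by simp)) (D.idc _)) := by simp
    exact this
  left_unitality {x y} m := by
    refine FinFamOp.single_ext (fun _ => rfl) fun b => heq_of_eq ?_
    have : D.vcomp (D.hcomp (D.idc (D.unit x)) (D.idc m) (by simp))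
        (D.vcomp (D.idc _) (D.lunit m)) = D.lunit m := by simp
    exact this
  right_unitality {x y} m := by
    refine FinFamOp.single_ext (fun _ => rfl) fun b => heq_of_eq ?_
    have : D.vcomp (D.hcomp (D.idc m) (D.idc (D.unit y)) (by simp))
        (D.vcomp (D.idc _) (D.runit m)) = D.runit m := by simp
    exact this

/-- `D` has iso-strong finite products: `Δ : D → FinFamOp D` has a lax right adjoint `P` (that is,
`D` has lax finite products) such that the composition comparison
`P M ⊙ P N → P (M ⊙ N)` is invertible for all families `M : X ⇸ Y` and `N : Y ⇸ Z`, indexed by spans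
`I ← A → J` and `J ← B → K`, for which the legs `A → J` and `J ← B` are bijections, and such that all
identity comparisons `id_{P X} → P (id_X)` are invertible. -/
def HasIsoStrongFiniteProducts (D : DblCat.{v₁, v₂, u₁, u₂}) : Prop :=
  ∃ (P : LaxDblFunctor (FinFamOp.{t} D) D) (_ : LaxDblAdjunction (diagonal.{t} D) P),
    (∀ {X Y Z : FinFamOp.Fam.{t} D} (M : FinFamOp.Pro X Y) (N : FinFamOp.Pro Y Z),
      Function.Bijective M.r → Function.Bijective N.l → D.IsIsoCell (P.laxator M N)) ∧
    ∀ X : FinFamOp.Fam.{t} D, D.IsIsoCell (P.unitor X)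

/-! ### Matrices -/

/-- The tensor product of `V` distributes over (small) coproducts, separately in each variable:
the canonical maps `∐ (X ⊗ Yᵢ) ⟶ X ⊗ ∐ Yᵢ` and `∐ (Yᵢ ⊗ X) ⟶ (∐ Yᵢ) ⊗ X` are isomorphisms. -/
class MonoidalDistributive (V : Type u) [Category.{v} V] [MonoidalCategory V]
    [HasCoproducts.{w} V] : Prop where
  left : ∀ (X : V) {I : Type w} (Y : I → V),
    IsIso (Sigma.desc fun i => X ◁ Sigma.ι Y i : (∐ fun i => X ⊗ Y i) ⟶ X ⊗ ∐ Y)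
  right : ∀ (X : V) {I : Type w} (Y : I → V),
    IsIso (Sigma.desc fun i => Sigma.ι Y i ▷ X : (∐ fun i => Y i ⊗ X) ⟶ (∐ Y) ⊗ X)

/-- A category with finite products and small coproducts is distributive if finite products
distribute over coproducts: the canonical maps `∐ (X × Yᵢ) ⟶ X × ∐ Yᵢ` are isomorphisms. -/
class DistributiveCategory (V : Type u) [Category.{v} V] [CartesianMonoidalCategory V]
    [HasCoproducts.{w} V] : Prop where
  isIso : ∀ (X : V) {I : Type w} (Y : I → V),
    IsIso (Sigma.desc fun i => X ◁ Sigma.ι Y i : (∐ fun i => X ⊗ Y i) ⟶ X ⊗ ∐ Y)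

instance DistributiveCategory.monoidalDistributive (V : Type u) [Category.{v} V]
    [CartesianMonoidalCategory V] [HasCoproducts.{w} V] [DistributiveCategory.{w} V] :
    MonoidalDistributive.{w} V where
  left := DistributiveCategory.isIso
  right X I Y := by
    let _ : BraidedCategory V := .ofCartesianMonoidalCategory
    have := DistributiveCategory.isIso X Y
    have e : (Sigma.desc fun i => Sigma.ι Y i ▷ X : (∐ fun i => Y i ⊗ X) ⟶ (∐ Y) ⊗ X)
        = (Sigma.mapIso fun i => β_ (Y i) X).hom ≫
          (Sigma.desc fun i => X ◁ Sigma.ι Y i) ≫ (β_ X (∐ Y)).hom := by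
      refine Sigma.hom_ext _ _ fun i => ?_
      simp
    rw [e]
    infer_instance

noncomputable section

namespace VMat

section

variable {V : Type u} [Category.{v} V] [MonoidalCategory V] [HasCoproducts.{w} V]
  [MonoidalDistributive.{w} V]

def descL (X : V) {I : Type w} {Y : I → V} {Z : V} (f : ∀ i, X ⊗ Y i ⟶ Z) : X ⊗ ∐ Y ⟶ Z :=
  have := MonoidalDistributive.left X Y
  inv (Sigma.desc fun i => X ◁ Sigma.ι Y i) ≫ Sigma.desc f

def descR (X : V) {I : Type w} {Y : I → V} {Z : V} (f : ∀ i, Y i ⊗ X ⟶ Z) : (∐ Y) ⊗ X ⟶ Z :=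
  have := MonoidalDistributive.right X Y
  inv (Sigma.desc fun i => Sigma.ι Y i ▷ X) ≫ Sigma.desc f

theorem ι_descL (X : V) {I : Type w} {Y : I → V} {Z : V} (f : ∀ i, X ⊗ Y i ⟶ Z) (i : I) :
    X ◁ Sigma.ι Y i ≫ descL X f = f i := by
  have := MonoidalDistributive.left X Y
  have h : X ◁ Sigma.ι Y i
      = Sigma.ι (fun i => X ⊗ Y i) i ≫ Sigma.desc fun i => X ◁ Sigma.ι Y i := by simp
  rw [h, descL, Category.assoc, IsIso.hom_inv_id_assoc, Sigma.ι_desc]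

theorem ι_descR (X : V) {I : Type w} {Y : I → V} {Z : V} (f : ∀ i, Y i ⊗ X ⟶ Z) (i : I) :
    Sigma.ι Y i ▷ X ≫ descR X f = f i := by
  have := MonoidalDistributive.right X Y
  have h : Sigma.ι Y i ▷ X
      = Sigma.ι (fun i => Y i ⊗ X) i ≫ Sigma.desc fun i => Sigma.ι Y i ▷ X := by simp
  rw [h, descR, Category.assoc, IsIso.hom_inv_id_assoc, Sigma.ι_desc]

theorem hom_extL {X : V} {I : Type w} {Y : I → V} {Z : V} {f g : X ⊗ ∐ Y ⟶ Z}
    (h : ∀ i, X ◁ Sigma.ι Y i ≫ f = X ◁ Sigma.ι Y i ≫ g) : f = g := by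
  have := MonoidalDistributive.left X Y
  rw [← cancel_epi (Sigma.desc fun i => X ◁ Sigma.ι Y i)]
  ext i; simpa using h i

theorem hom_extR {X : V} {I : Type w} {Y : I → V} {Z : V} {f g : (∐ Y) ⊗ X ⟶ Z}
    (h : ∀ i, Sigma.ι Y i ▷ X ≫ f = Sigma.ι Y i ▷ X ≫ g) : f = g := by
  have := MonoidalDistributive.right X Y
  rw [← cancel_epi (Sigma.desc fun i => Sigma.ι Y i ▷ X)]
  ext i; simpa using h i

theorem hom_extLR {X Q : V} {I : Type w} {Y : I → V} {Z : V} {f g : (X ⊗ ∐ Y) ⊗ Q ⟶ Z}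
    (h : ∀ i, (X ◁ Sigma.ι Y i) ▷ Q ≫ f = (X ◁ Sigma.ι Y i) ▷ Q ≫ g) : f = g := by
  have := MonoidalDistributive.left X Y
  rw [← cancel_epi ((Sigma.desc fun i => X ◁ Sigma.ι Y i) ▷ Q)]
  refine hom_extR fun i => ?_
  rw [← comp_whiskerRight_assoc, ← comp_whiskerRight_assoc, Sigma.ι_desc]
  exact h i

end

variable {V : Type u} [Category.{v} V]

/-- A cell between `V`-matrices: functions on indices with arrows `M(x, y) ⟶ M'(f x, g y)`. -/
structure Cell {X Y X' Y' : Type w} (M : X → Y → V) (M' : X' → Y' → V) where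
  left : X ⟶ X'
  right : Y ⟶ Y'
  app : ∀ x y, M x y ⟶ M' (left x) (right y)

theorem Cell.ext' {X Y X' Y' : Type w} {M : X → Y → V} {M' : X' → Y' → V} {α β : Cell M M'}
    (hl : α.left = β.left) (hr : α.right = β.right) (h : ∀ x y, HEq (α.app x y) (β.app x y)) :
    α = β := by
  obtain ⟨l, r, a⟩ := α
  obtain ⟨l', r', b⟩ := β
  obtain rfl : l = l' := hl
  obtain rfl : r = r' := hr
  obtain rfl : a = b := by funext x y; exact eq_of_heq (h x y)
  rfl

/-- The components of a cell with its left boundary replaced by an equal function. -/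
def Cell.appOf {X Y X' Y' : Type w} {M : X → Y → V} {M' : X' → Y' → V} (α : Cell M M')
    {f : X ⟶ X'} (h : f = α.left) (x : X) (y : Y) : M x y ⟶ M' (f x) (α.right y) := by
  subst h
  exact α.app x y

variable [MonoidalCategory V] [HasCoproducts.{w} V]

/-- Matrix multiplication. -/
def comp {X Y Z : Type w} (M : X → Y → V) (N : Y → Z → V) (x : X) (z : Z) : V :=
  ∐ fun y => M x y ⊗ N y z

/-- The identity matrix, with the unit object on the diagonal and the initial object elsewhere: the
coproduct of copies of the unit object indexed by the set of proofs of `x = y`. -/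
def unit (X : Type w) (x y : X) : V := ∐ fun _ : ULift.{w} (PLift (x = y)) => 𝟙_ V

section

variable {X Y Z W U : Type w} {M : X → Y → V} {N : Y → Z → V} {K : Z → W → V} {L : W → U → V}

def compι (M : X → Y → V) (N : Y → Z → V) (x : X) (y : Y) (z : Z) :
    M x y ⊗ N y z ⟶ comp M N x z :=
  Sigma.ι (fun y => M x y ⊗ N y z) y

def compDesc {x : X} {z : Z} {T : V} (f : ∀ y, M x y ⊗ N y z ⟶ T) : comp M N x z ⟶ T :=
  Sigma.desc f

@[simp]
theorem compι_desc {x : X} {z : Z} {T : V} (f : ∀ y, M x y ⊗ N y z ⟶ T) (y : Y) :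
    compι M N x y z ≫ compDesc f = f y :=
  Sigma.ι_desc _ _

@[simp]
theorem compι_desc_assoc {x : X} {z : Z} {T T' : V} (f : ∀ y, M x y ⊗ N y z ⟶ T) (y : Y)
    (g : T ⟶ T') : compι M N x y z ≫ compDesc f ≫ g = f y ≫ g := by
  rw [← Category.assoc, compι_desc]

theorem comp_ext {x : X} {z : Z} {T : V} {f g : comp M N x z ⟶ T}
    (h : ∀ y, compι M N x y z ≫ f = compι M N x y z ≫ g) : f = g :=
  Sigma.hom_ext _ _ h

def unitι (x y : X) (h : x = y) : (𝟙_ V) ⟶ unit X x y :=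
  Sigma.ι (fun _ : ULift.{w} (PLift (x = y)) => 𝟙_ V) ⟨⟨h⟩⟩

def unitDesc {x y : X} {T : V} (f : x = y → (𝟙_ V ⟶ T)) : unit X x y ⟶ T :=
  Sigma.desc fun h => f h.down.down

@[simp]
theorem unitι_desc {x y : X} {T : V} (f : x = y → (𝟙_ V ⟶ T)) (h : x = y) :
    unitι x y h ≫ unitDesc f = f h :=
  Sigma.ι_desc _ _

theorem unit_ext {x y : X} {T : V} {f g : unit X x y ⟶ T}
    (h : ∀ e : x = y, unitι x y e ≫ f = unitι x y e ≫ g) : f = g :=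
  Sigma.hom_ext _ _ fun e => h e.down.down

/-- The components of the identity cell on a function. -/
def unitMap (f : X → Y) (x y : X) : (unit X x y : V) ⟶ unit Y (f x) (f y) :=
  unitDesc fun h => unitι _ _ (congrArg f h)

@[simp]
theorem unitι_map (f : X → Y) (x y : X) (h : x = y) :
    unitι x y h ≫ unitMap (V := V) f x y = unitι _ _ (congrArg f h) :=
  unitι_desc _ _

theorem unitMap_id (x y : X) : unitMap (fun x : X => x) x y = 𝟙 (unit X x y : V) :=
  unit_ext fun h => by simp

theorem unitMap_comp (f : X → Y) (g : Y → Z) (x y : X) :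
    unitMap (V := V) (fun x => g (f x)) x y = unitMap f x y ≫ unitMap g (f x) (f y) :=
  unit_ext fun h => by simp [← Category.assoc]

section

variable [MonoidalDistributive.{w} V]

def compDescL (P : V) {x : X} {z : Z} {T : V} (f : ∀ y, P ⊗ (M x y ⊗ N y z) ⟶ T) :
    P ⊗ comp M N x z ⟶ T :=
  descL P f

def compDescR (P : V) {x : X} {z : Z} {T : V} (f : ∀ y, (M x y ⊗ N y z) ⊗ P ⟶ T) :
    comp M N x z ⊗ P ⟶ T :=
  descR P f

@[simp]
theorem compι_descL (P : V) {x : X} {z : Z} {T : V} (f : ∀ y, P ⊗ (M x y ⊗ N y z) ⟶ T) (y : Y) :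
    P ◁ compι M N x y z ≫ compDescL P f = f y :=
  ι_descL _ _ _

@[simp]
theorem compι_descL_assoc (P : V) {x : X} {z : Z} {T T' : V} (f : ∀ y, P ⊗ (M x y ⊗ N y z) ⟶ T)
    (y : Y) (g : T ⟶ T') : P ◁ compι M N x y z ≫ compDescL P f ≫ g = f y ≫ g := by
  rw [← Category.assoc, compι_descL]

@[simp]
theorem compι_descR (P : V) {x : X} {z : Z} {T : V} (f : ∀ y, (M x y ⊗ N y z) ⊗ P ⟶ T) (y : Y) :
    compι M N x y z ▷ P ≫ compDescR P f = f y :=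
  ι_descR _ _ _

@[simp]
theorem compι_descR_assoc (P : V) {x : X} {z : Z} {T T' : V} (f : ∀ y, (M x y ⊗ N y z) ⊗ P ⟶ T)
    (y : Y) (g : T ⟶ T') : compι M N x y z ▷ P ≫ compDescR P f ≫ g = f y ≫ g := by
  rw [← Category.assoc, compι_descR]

theorem comp_extL {P : V} {x : X} {z : Z} {T : V} {f g : P ⊗ comp M N x z ⟶ T}
    (h : ∀ y, P ◁ compι M N x y z ≫ f = P ◁ compι M N x y z ≫ g) : f = g :=
  hom_extL h

theorem comp_extR {P : V} {x : X} {z : Z} {T : V} {f g : comp M N x z ⊗ P ⟶ T}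
    (h : ∀ y, compι M N x y z ▷ P ≫ f = compι M N x y z ▷ P ≫ g) : f = g :=
  hom_extR h

theorem comp_extRR {P Q : V} {x : X} {z : Z} {T : V} {f g : (comp M N x z ⊗ P) ⊗ Q ⟶ T}
    (h : ∀ y, compι M N x y z ▷ P ▷ Q ≫ f = compι M N x y z ▷ P ▷ Q ≫ g) : f = g := by
  rw [← cancel_epi (α_ _ _ _).inv]
  refine comp_extR fun y => ?_
  have := h y
  rw [← cancel_epi (α_ _ _ _).inv] at this
  simpa using this

def unitDescL (P : V) {x y : X} {T : V} (f : x = y → (P ⊗ 𝟙_ V ⟶ T)) : P ⊗ unit X x y ⟶ T :=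
  descL P fun h => f h.down.down

def unitDescR (P : V) {x y : X} {T : V} (f : x = y → (𝟙_ V ⊗ P ⟶ T)) : unit X x y ⊗ P ⟶ T :=
  descR P fun h => f h.down.down

@[simp]
theorem unitι_descL (P : V) {x y : X} {T : V} (f : x = y → (P ⊗ 𝟙_ V ⟶ T)) (h : x = y) :
    P ◁ unitι x y h ≫ unitDescL P f = f h :=
  ι_descL _ _ _

@[simp]
theorem unitι_descL_assoc (P : V) {x y : X} {T T' : V} (f : x = y → (P ⊗ 𝟙_ V ⟶ T)) (h : x = y)
    (g : T ⟶ T') : P ◁ unitι x y h ≫ unitDescL P f ≫ g = f h ≫ g := by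
  rw [← Category.assoc, unitι_descL]

@[simp]
theorem unitι_descR (P : V) {x y : X} {T : V} (f : x = y → (𝟙_ V ⊗ P ⟶ T)) (h : x = y) :
    unitι x y h ▷ P ≫ unitDescR P f = f h :=
  ι_descR _ _ _

@[simp]
theorem unitι_descR_assoc (P : V) {x y : X} {T T' : V} (f : x = y → (𝟙_ V ⊗ P ⟶ T)) (h : x = y)
    (g : T ⟶ T') : unitι x y h ▷ P ≫ unitDescR P f ≫ g = f h ≫ g := by
  rw [← Category.assoc, unitι_descR]

theorem unit_extL {P : V} {x y : X} {T : V} {f g : P ⊗ unit X x y ⟶ T}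
    (h : ∀ e : x = y, P ◁ unitι x y e ≫ f = P ◁ unitι x y e ≫ g) : f = g :=
  hom_extL fun e => h e.down.down

theorem unit_extR {P : V} {x y : X} {T : V} {f g : unit X x y ⊗ P ⟶ T}
    (h : ∀ e : x = y, unitι x y e ▷ P ≫ f = unitι x y e ▷ P ≫ g) : f = g :=
  hom_extR fun e => h e.down.down

theorem unit_extLR {P Q : V} {x y : X} {T : V} {f g : (P ⊗ unit X x y) ⊗ Q ⟶ T}
    (h : ∀ e : x = y, (P ◁ unitι x y e) ▷ Q ≫ f = (P ◁ unitι x y e) ▷ Q ≫ g) : f = g :=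
  hom_extLR fun e => h e.down.down

end

/-- The components of the external composite of two cells. -/
def hmap {X' Y' Z' : Type w} {M' : X' → Y' → V} {N' : Y' → Z' → V} {f : X → X'} {g : Y → Y'}
    {k : Z → Z'} (a : ∀ x y, M x y ⟶ M' (f x) (g y)) (b : ∀ y z, N y z ⟶ N' (g y) (k z))
    (x : X) (z : Z) : comp M N x z ⟶ comp M' N' (f x) (k z) :=
  compDesc fun y => (a x y ⊗ₘ b y z) ≫ compι M' N' (f x) (g y) (k z)

@[simp]
theorem compι_hmap {X' Y' Z' : Type w} {M' : X' → Y' → V} {N' : Y' → Z' → V} {f : X → X'}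
    {g : Y → Y'} {k : Z → Z'} (a : ∀ x y, M x y ⟶ M' (f x) (g y))
    (b : ∀ y z, N y z ⟶ N' (g y) (k z)) (x : X) (y : Y) (z : Z) :
    compι M N x y z ≫ hmap a b x z = (a x y ⊗ₘ b y z) ≫ compι M' N' (f x) (g y) (k z) :=
  compι_desc _ _

@[simp]
theorem compι_hmap_assoc {X' Y' Z' : Type w} {M' : X' → Y' → V} {N' : Y' → Z' → V} {f : X → X'}
    {g : Y → Y'} {k : Z → Z'} (a : ∀ x y, M x y ⟶ M' (f x) (g y))
    (b : ∀ y z, N y z ⟶ N' (g y) (k z)) (x : X) (y : Y) (z : Z) {T : V}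
    (c : comp M' N' (f x) (k z) ⟶ T) :
    compι M N x y z ≫ hmap a b x z ≫ c
      = (a x y ⊗ₘ b y z) ≫ compι M' N' (f x) (g y) (k z) ≫ c := by
  rw [← Category.assoc, compι_hmap, Category.assoc]

theorem hmap_id (M : X → Y → V) (N : Y → Z → V) (x : X) (z : Z) :
    hmap (f := fun x => x) (g := fun y => y) (k := fun z => z) (fun x y => 𝟙 (M x y))
      (fun y z => 𝟙 (N y z)) x z = 𝟙 (comp M N x z) := by
  refine comp_ext fun y => ?_
  simp

theorem hmap_comp {X' Y' Z' X'' Y'' Z'' : Type w} {M' : X' → Y' → V} {N' : Y' → Z' → V}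
    {M'' : X'' → Y'' → V} {N'' : Y'' → Z'' → V} {f : X → X'} {g : Y → Y'} {k : Z → Z'}
    {f' : X' → X''} {g' : Y' → Y''} {k' : Z' → Z''}
    (a : ∀ x y, M x y ⟶ M' (f x) (g y)) (b : ∀ y z, N y z ⟶ N' (g y) (k z))
    (a' : ∀ x y, M' x y ⟶ M'' (f' x) (g' y)) (b' : ∀ y z, N' y z ⟶ N'' (g' y) (k' z))
    (x : X) (z : Z) :
    hmap (f := fun x => f' (f x)) (g := fun x => g' (g x)) (k := fun x => k' (k x))
      (fun x y => a x y ≫ a' _ _) (fun y z => b y z ≫ b' _ _) x z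
      = hmap a b x z ≫ hmap a' b' (f x) (k z) := by
  refine comp_ext fun y => ?_
  simp

section

variable [MonoidalDistributive.{w} V]

def assocApp (M : X → Y → V) (N : Y → Z → V) (K : Z → W → V) (x : X) (u : W) :
    comp (comp M N) K x u ⟶ comp M (comp N K) x u :=
  compDesc fun z => compDescR (K z u) fun y => (α_ (M x y) (N y z) (K z u)).hom ≫
    M x y ◁ compι N K y z u ≫ compι M (comp N K) x y u

def assocInvApp (M : X → Y → V) (N : Y → Z → V) (K : Z → W → V) (x : X) (u : W) :
    comp M (comp N K) x u ⟶ comp (comp M N) K x u :=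
  compDesc fun y => compDescL (M x y) fun z => (α_ (M x y) (N y z) (K z u)).inv ≫
    compι M N x y z ▷ K z u ≫ compι (comp M N) K x z u

theorem ι_assocApp (M : X → Y → V) (N : Y → Z → V) (K : Z → W → V) (x : X) (y : Y) (z : Z) (u : W) :
    compι M N x y z ▷ K z u ≫ compι (comp M N) K x z u ≫ assocApp M N K x u
      = (α_ (M x y) (N y z) (K z u)).hom ≫ M x y ◁ compι N K y z u ≫
        compι M (comp N K) x y u := by
  simp [assocApp]

theorem assoc_inv (M : X → Y → V) (N : Y → Z → V) (K : Z → W → V) (x : X) (u : W) :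
    assocApp M N K x u ≫ assocInvApp M N K x u = 𝟙 _ := by
  refine comp_ext fun z => comp_extR fun y => ?_
  simp [assocApp, assocInvApp]

theorem inv_assoc (M : X → Y → V) (N : Y → Z → V) (K : Z → W → V) (x : X) (u : W) :
    assocInvApp M N K x u ≫ assocApp M N K x u = 𝟙 _ := by
  refine comp_ext fun z => comp_extL fun y => ?_
  simp [assocApp, assocInvApp]

theorem assoc_natural {X' Y' Z' W' : Type w} {M' : X' → Y' → V} {N' : Y' → Z' → V}
    {K' : Z' → W' → V} {f : X → X'} {g : Y → Y'} {k : Z → Z'} {l : W → W'}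
    (a : ∀ x y, M x y ⟶ M' (f x) (g y)) (b : ∀ y z, N y z ⟶ N' (g y) (k z))
    (c : ∀ z w, K z w ⟶ K' (k z) (l w)) (x : X) (u : W) :
    hmap (hmap a b) c x u ≫ assocApp M' N' K' (f x) (l u)
      = assocApp M N K x u ≫ hmap a (hmap b c) x u := by
  refine comp_ext fun z => comp_extR fun y => ?_
  rw [compι_hmap_assoc, whiskerRight_comp_tensorHom_assoc, compι_hmap,
    ← tensorHom_comp_whiskerRight_assoc, ι_assocApp, reassoc_of% ι_assocApp, compι_hmap,
    whiskerLeft_comp_tensorHom_assoc, compι_hmap, ← tensorHom_comp_whiskerLeft_assoc,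
    associator_naturality_assoc]

theorem pentagon (M : X → Y → V) (N : Y → Z → V) (K : Z → W → V) (L : W → U → V) (x : X) (u : U) :
    hmap (f := fun x => x) (g := fun x => x) (k := fun x => x) (assocApp M N K)
        (fun w u => 𝟙 (L w u)) x u ≫ assocApp M (comp N K) L x u ≫
      hmap (f := fun x => x) (g := fun x => x) (k := fun x => x) (fun x y => 𝟙 (M x y))
        (assocApp N K L) x u
      = assocApp (comp M N) K L x u ≫ assocApp M N (comp K L) x u := by
  refine comp_ext fun w => comp_extR fun z => comp_extRR fun y => ?_
  have e₁ : compι M N x y z ▷ K z w ▷ L w u ≫ compι (comp M N) K x z w ▷ L w u ≫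
      assocApp M N K x w ▷ L w u
      = (α_ (M x y) (N y z) (K z w)).hom ▷ L w u ≫ (M x y ◁ compι N K y z w) ▷ L w u ≫
        compι M (comp N K) x y w ▷ L w u := by
    simp only [← comp_whiskerRight, ι_assocApp]
  have e₂ : M x y ◁ compι N K y z w ▷ L w u ≫ M x y ◁ compι (comp N K) L y w u ≫
      M x y ◁ assocApp N K L y u
      = M x y ◁ (α_ (N y z) (K z w) (L w u)).hom ≫ M x y ◁ N y z ◁ compι K L z w u ≫
        M x y ◁ compι N (comp K L) y z u := by
    simp only [← MonoidalCategory.whiskerLeft_comp, ι_assocApp]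
  have e₃ := ι_assocApp M (comp N K) L x y w u
  have e₄ := ι_assocApp M N (comp K L) x y z u
  have e₅ := ι_assocApp (comp M N) K L x z w u
  rw [compι_hmap_assoc, tensorHom_id, reassoc_of% e₁, reassoc_of% e₃, compι_hmap, id_tensorHom,
    whisker_assoc_assoc, Iso.inv_hom_id_assoc, reassoc_of% e₂, reassoc_of% e₅,
    associator_naturality_left_assoc, ← whisker_exchange_assoc, e₄]
  simp

def lunitApp (M : X → Y → V) (x : X) (y : Y) : comp (unit X) M x y ⟶ M x y :=
  compDesc fun x' => unitDescR (M x' y) fun h => (λ_ (M x' y)).hom ≫ eqToHom (by rw [h])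

def runitApp (M : X → Y → V) (x : X) (y : Y) : comp M (unit Y) x y ⟶ M x y :=
  compDesc fun y' => unitDescL (M x y') fun h => (ρ_ (M x y')).hom ≫ eqToHom (by rw [h])

end

def lunitInvApp (M : X → Y → V) (x : X) (y : Y) : M x y ⟶ comp (unit X) M x y :=
  (λ_ (M x y)).inv ≫ unitι x x rfl ▷ M x y ≫ compι (unit X) M x x y

def runitInvApp (M : X → Y → V) (x : X) (y : Y) : M x y ⟶ comp M (unit Y) x y :=
  (ρ_ (M x y)).inv ≫ M x y ◁ unitι y y rfl ≫ compι M (unit Y) x y y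

variable [MonoidalDistributive.{w} V]

theorem lunit_inv (M : X → Y → V) (x : X) (y : Y) :
    lunitApp M x y ≫ lunitInvApp M x y = 𝟙 _ := by
  refine comp_ext fun x' => unit_extR fun h => ?_
  subst h
  simp [lunitApp, lunitInvApp]

theorem inv_lunit (M : X → Y → V) (x : X) (y : Y) :
    lunitInvApp M x y ≫ lunitApp M x y = 𝟙 _ := by
  simp [lunitApp, lunitInvApp]

theorem runit_inv (M : X → Y → V) (x : X) (y : Y) :
    runitApp M x y ≫ runitInvApp M x y = 𝟙 _ := by
  refine comp_ext fun x' => unit_extL fun h => ?_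
  subst h
  simp [runitApp, runitInvApp]

theorem inv_runit (M : X → Y → V) (x : X) (y : Y) :
    runitInvApp M x y ≫ runitApp M x y = 𝟙 _ := by
  simp [runitApp, runitInvApp]

theorem lunit_natural {X' Y' : Type w} {M' : X' → Y' → V} {f : X → X'} {g : Y → Y'}
    (a : ∀ x y, M x y ⟶ M' (f x) (g y)) (x : X) (y : Y) :
    hmap (unitMap f) a x y ≫ lunitApp M' (f x) (g y) = lunitApp M x y ≫ a x y := by
  refine comp_ext fun x' => unit_extR fun h => ?_
  subst h
  simp only [lunitApp, compι_hmap_assoc, compι_desc, compι_desc_assoc,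
    whiskerRight_comp_tensorHom_assoc, unitι_map]
  simp [MonoidalCategory.tensorHom_def']

theorem runit_natural {X' Y' : Type w} {M' : X' → Y' → V} {f : X → X'} {g : Y → Y'}
    (a : ∀ x y, M x y ⟶ M' (f x) (g y)) (x : X) (y : Y) :
    hmap a (unitMap g) x y ≫ runitApp M' (f x) (g y) = runitApp M x y ≫ a x y := by
  refine comp_ext fun x' => unit_extL fun h => ?_
  subst h
  simp only [runitApp, compι_hmap_assoc, compι_desc, compι_desc_assoc,
    whiskerLeft_comp_tensorHom_assoc, unitι_map]
  simp [MonoidalCategory.tensorHom_def]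

theorem triangle (M : X → Y → V) (N : Y → Z → V) (x : X) (z : Z) :
    assocApp M (unit Y) N x z ≫
      hmap (f := fun x => x) (g := fun x => x) (k := fun x => x) (fun x y => 𝟙 (M x y))
        (lunitApp N) x z
      = hmap (f := fun x => x) (g := fun x => x) (k := fun x => x) (runitApp M)
        (fun y z => 𝟙 (N y z)) x z := by
  refine comp_ext fun y => comp_extR fun y' => ?_
  rw [reassoc_of% ι_assocApp, compι_hmap, compι_hmap, tensorHom_id, id_tensorHom]
  rw [← MonoidalCategory.whiskerLeft_comp_assoc, ← comp_whiskerRight_assoc, lunitApp, runitApp,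
    compι_desc, compι_desc]
  refine unit_extLR fun h => ?_
  subst h
  rw [associator_naturality_middle_assoc, ← MonoidalCategory.whiskerLeft_comp_assoc,
    ← comp_whiskerRight_assoc]
  simp

end

end VMat

/-- The double category of `V`-matrices: its objects are sets, its arrows are functions, its proarrows
`X ⇸ Y` are families `M(x, y)` of objects of `V`, and proarrows compose by matrix multiplication
`(M ⊙ N)(x, z) = ∐_y M(x, y) ⊗ N(y, z)`. -/
def VMat (V : Type u) [Category.{v} V] [MonoidalCategory V] [HasCoproducts.{w} V]
    [MonoidalDistributive.{w} V] : DblCat where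
  Obj := Type w
  Pro X Y := X → Y → V
  Cell := VMat.Cell
  left := VMat.Cell.left
  right := VMat.Cell.right
  idc M := ⟨𝟙 _, 𝟙 _, fun x y => 𝟙 (M x y)⟩
  vcomp α β := ⟨α.left ≫ β.left, α.right ≫ β.right, fun x y => α.app x y ≫ β.app _ _⟩
  left_idc _ := rfl
  right_idc _ := rfl
  left_vcomp _ _ := rfl
  right_vcomp _ _ := rfl
  id_vcomp α := VMat.Cell.ext' rfl rfl fun _ _ => heq_of_eq (Category.id_comp _)
  vcomp_id α := VMat.Cell.ext' rfl rfl fun _ _ => heq_of_eq (Category.comp_id _)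
  vcomp_assoc _ _ _ := VMat.Cell.ext' rfl rfl fun _ _ => heq_of_eq (Category.assoc _ _ _)
  comp := VMat.comp
  hcomp α β h := ⟨α.left, β.right, VMat.hmap α.app (β.appOf h)⟩
  left_hcomp _ _ _ := rfl
  right_hcomp _ _ _ := rfl
  hcomp_idc M N := VMat.Cell.ext' rfl rfl fun x z => heq_of_eq (VMat.hmap_id M N x z)
  hcomp_vcomp α β α' β' h h' := by
    obtain ⟨l, r, b⟩ := β
    obtain ⟨l', r', b'⟩ := β'
    obtain rfl : α.right = l := h
    obtain rfl : α'.right = l' := h'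
    exact VMat.Cell.ext' rfl rfl fun x z => heq_of_eq (VMat.hmap_comp α.app b α'.app b' x z)
  unit := VMat.unit
  hid f := ⟨f, f, VMat.unitMap f⟩
  left_hid _ := rfl
  right_hid _ := rfl
  hid_id X := VMat.Cell.ext' rfl rfl fun x y => heq_of_eq (VMat.unitMap_id x y)
  hid_comp f g := VMat.Cell.ext' rfl rfl fun x y => heq_of_eq (VMat.unitMap_comp f g x y)
  assoc M N K := ⟨𝟙 _, 𝟙 _, VMat.assocApp M N K⟩
  assocInv M N K := ⟨𝟙 _, 𝟙 _, VMat.assocInvApp M N K⟩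
  left_assoc _ _ _ := rfl
  right_assoc _ _ _ := rfl
  assoc_assocInv M N K := VMat.Cell.ext' rfl rfl fun x u => heq_of_eq (VMat.assoc_inv M N K x u)
  assocInv_assoc M N K := VMat.Cell.ext' rfl rfl fun x u => heq_of_eq (VMat.inv_assoc M N K x u)
  assoc_natural α β γ h h' := by
    obtain ⟨l, r, b⟩ := β
    obtain ⟨l', r', c⟩ := γ
    obtain rfl : α.right = l := h
    obtain rfl : r = l' := h'
    exact VMat.Cell.ext' rfl rfl fun x u => heq_of_eq (VMat.assoc_natural α.app b c x u)
  lunit M := ⟨𝟙 _, 𝟙 _, VMat.lunitApp M⟩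
  lunitInv M := ⟨𝟙 _, 𝟙 _, VMat.lunitInvApp M⟩
  left_lunit _ := rfl
  right_lunit _ := rfl
  lunit_lunitInv M := VMat.Cell.ext' rfl rfl fun x y => heq_of_eq (VMat.lunit_inv M x y)
  lunitInv_lunit M := VMat.Cell.ext' rfl rfl fun x y => heq_of_eq (VMat.inv_lunit M x y)
  lunit_natural α := VMat.Cell.ext' rfl rfl fun x y => heq_of_eq (VMat.lunit_natural α.app x y)
  runit M := ⟨𝟙 _, 𝟙 _, VMat.runitApp M⟩
  runitInv M := ⟨𝟙 _, 𝟙 _, VMat.runitInvApp M⟩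
  left_runit _ := rfl
  right_runit _ := rfl
  runit_runitInv M := VMat.Cell.ext' rfl rfl fun x y => heq_of_eq (VMat.runit_inv M x y)
  runitInv_runit M := VMat.Cell.ext' rfl rfl fun x y => heq_of_eq (VMat.inv_runit M x y)
  runit_natural α := VMat.Cell.ext' rfl rfl fun x y => heq_of_eq (VMat.runit_natural α.app x y)
  pentagon M N K L := VMat.Cell.ext' rfl rfl fun x u => heq_of_eq (VMat.pentagon M N K L x u)
  triangle M N := VMat.Cell.ext' rfl rfl fun x z => heq_of_eq (VMat.triangle M N x z)

end

/-! The argument has two independent halves: a formal construction of the lax right adjoint, and one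
distributive law in `V`.

Formal half. The comparison cells of `Δ` are invertible. For such a double functor `L`, a lax right
adjoint exists as soon as each object and each proarrow of the codomain has a universal arrow,
respectively a universal cell, from `L`, with the boundary of the universal cell given by the
universal arrows. This is doctrinal adjunction: the comparisons of the right adjoint are the mates
of the inverse comparisons of `L`, and every axiom can be checked after applying `L` and composing
with a universal cell. For matrices the universal objects are finite products: `Π X` is the set `∏
i, X i`, and `Π M` has entries `(Π M)(x, y) = ∏ a, M_a(x_{l a}, y_{r a})`, with the projections as
universal cells.

Distributive half. At `(x, z)` the composition comparison goes from the coproduct over `y ∈ ∏ j, Y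
j` of `(∏ a, M_a) × (∏ b, N_b)` to the product over composable pairs `(a, b)` of the coproducts over
`y_j` of `M_a × N_b`. When the two legs into `J` are bijections, `A`, `B` and the pullback are all
copies of `J`, so the source becomes `∐ y, ∏ j, M_j(x, y_j) × N_j(y_j, z)` and the target `∏ j, ∐
y_j, M_j × N_j`. The comparison is then the law that a finite product of coproducts is the
coproduct, over choice functions, of products. The identity comparison is an instance of the same
law: `id(x, y)` is a coproduct of copies of `1` over the proofs of `x = y`, a proof of `x = y` is a
choice of proofs of `x i = y i`, and a product of copies of `1` is `1`.

The law is `isIso_sigmaDesc_piMap`, proved by induction on the finite index set from the binary case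
`isIso_sigmaDesc_tensorHom`. The lemmas `isIso_piLaxator` and `isIso_piUnitor` reduce the
comparisons to it; `rightAdjoint_laxator` and `rightAdjoint_unitor` identify the formal comparisons
with the concrete ones. -/

/-! ### Strong double functors and universal cells. -/

/-- Invertibility of the comparison cells of a lax double functor, with chosen inverses. -/
structure LaxDblFunctor.StrongData {D : DblCat.{v₁, v₂, u₁, u₂}} {E : DblCat.{v₃, v₄, u₃, u₄}}
    (L : LaxDblFunctor D E) where
  laxInv : ∀ {x y z : D.Obj} (m : D.Pro x y) (n : D.Pro y z),
    E.Cell (L.pro (D.comp m n)) (E.comp (L.pro m) (L.pro n))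
  laxator_laxInv : ∀ {x y z : D.Obj} (m : D.Pro x y) (n : D.Pro y z),
    E.vcomp (L.laxator m n) (laxInv m n) = E.idc _
  laxInv_laxator : ∀ {x y z : D.Obj} (m : D.Pro x y) (n : D.Pro y z),
    E.vcomp (laxInv m n) (L.laxator m n) = E.idc _
  unitInv : ∀ x : D.Obj, E.Cell (L.pro (D.unit x)) (E.unit (L.obj x))
  unitor_unitInv : ∀ x : D.Obj, E.vcomp (L.unitor x) (unitInv x) = E.idc _
  unitInv_unitor : ∀ x : D.Obj, E.vcomp (unitInv x) (L.unitor x) = E.idc _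

/-- Universal arrows and universal cells from a lax double functor `L` to the objects and proarrows
of its codomain. -/
structure LaxDblFunctor.UniversalCells {D : DblCat.{v₁, v₂, u₁, u₂}}
    {E : DblCat.{v₃, v₄, u₃, u₄}} (L : LaxDblFunctor D E) where
  obj : E.Obj → D.Obj
  ε : ∀ X : E.Obj, L.obj (obj X) ⟶ X
  lift : ∀ {x : D.Obj} {X : E.Obj}, (L.obj x ⟶ X) → (x ⟶ obj X)
  lift_fac : ∀ {x : D.Obj} {X : E.Obj} (f : L.obj x ⟶ X), L.map (lift f) ≫ ε X = f
  hom_ext : ∀ {x : D.Obj} {X : E.Obj} {f g : x ⟶ obj X},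
    L.map f ≫ ε X = L.map g ≫ ε X → f = g
  pro : ∀ {X Y : E.Obj}, E.Pro X Y → D.Pro (obj X) (obj Y)
  εCell : ∀ {X Y : E.Obj} (M : E.Pro X Y), E.Cell (L.pro (pro M)) M
  left_εCell : ∀ {X Y : E.Obj} (M : E.Pro X Y), E.left (εCell M) = ε X
  right_εCell : ∀ {X Y : E.Obj} (M : E.Pro X Y), E.right (εCell M) = ε Y
  liftCell : ∀ {x y : D.Obj} {m : D.Pro x y} {X Y : E.Obj} {M : E.Pro X Y},
    E.Cell (L.pro m) M → D.Cell m (pro M)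
  liftCell_fac : ∀ {x y : D.Obj} {m : D.Pro x y} {X Y : E.Obj} {M : E.Pro X Y}
    (γ : E.Cell (L.pro m) M), E.vcomp (L.cell (liftCell γ)) (εCell M) = γ
  cell_ext : ∀ {x y : D.Obj} {m : D.Pro x y} {X Y : E.Obj} {M : E.Pro X Y}
    {α β : D.Cell m (pro M)},
    E.vcomp (L.cell α) (εCell M) = E.vcomp (L.cell β) (εCell M) → α = β

namespace LaxDblFunctor

variable {D : DblCat.{v₁, v₂, u₁, u₂}} {E : DblCat.{v₃, v₄, u₃, u₄}} {L : LaxDblFunctor D E}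

/-! ### The oplax structure formed by the inverse comparisons. -/

namespace StrongData

variable (S : L.StrongData)

@[simp]
theorem left_laxInv {x y z : D.Obj} (m : D.Pro x y) (n : D.Pro y z) :
    E.left (S.laxInv m n) = 𝟙 (L.obj x) :=
  E.left_inv_of_left _ _ (S.laxator_laxInv m n) (L.left_laxator m n)

@[simp]
theorem right_laxInv {x y z : D.Obj} (m : D.Pro x y) (n : D.Pro y z) :
    E.right (S.laxInv m n) = 𝟙 (L.obj z) :=
  E.right_inv_of_right _ _ (S.laxator_laxInv m n) (L.right_laxator m n)

@[simp]
theorem left_unitInv (x : D.Obj) : E.left (S.unitInv x) = 𝟙 (L.obj x) :=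
  E.left_inv_of_left _ _ (S.unitor_unitInv x) (L.left_unitor x)

@[simp]
theorem right_unitInv (x : D.Obj) : E.right (S.unitInv x) = 𝟙 (L.obj x) :=
  E.right_inv_of_right _ _ (S.unitor_unitInv x) (L.right_unitor x)

theorem laxator_laxInv_assoc {x y z : D.Obj} (m : D.Pro x y) (n : D.Pro y z) {p q : E.Obj}
    {K : E.Pro p q} (γ : E.Cell (E.comp (L.pro m) (L.pro n)) K) :
    E.vcomp (L.laxator m n) (E.vcomp (S.laxInv m n) γ) = γ := by
  rw [← E.vcomp_assoc, S.laxator_laxInv, E.id_vcomp]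

theorem laxInv_laxator_assoc {x y z : D.Obj} (m : D.Pro x y) (n : D.Pro y z) {p q : E.Obj}
    {K : E.Pro p q} (γ : E.Cell (L.pro (D.comp m n)) K) :
    E.vcomp (S.laxInv m n) (E.vcomp (L.laxator m n) γ) = γ := by
  rw [← E.vcomp_assoc, S.laxInv_laxator, E.id_vcomp]

theorem unitor_unitInv_assoc (x : D.Obj) {p q : E.Obj} {K : E.Pro p q}
    (γ : E.Cell (E.unit (L.obj x)) K) :
    E.vcomp (L.unitor x) (E.vcomp (S.unitInv x) γ) = γ := by
  rw [← E.vcomp_assoc, S.unitor_unitInv, E.id_vcomp]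

/-- Naturality of the laxator, conjugated by its inverses on both sides. Together with the coherence
laws below, this is what the right adjoint needs from `L`: its structure cells are mates of the
inverse comparisons. -/
theorem laxInv_natural {x y z x' y' z' : D.Obj} {m : D.Pro x y} {n : D.Pro y z}
    {m' : D.Pro x' y'} {n' : D.Pro y' z'} (α : D.Cell m m') (β : D.Cell n n')
    (h : D.right α = D.left β) :
    E.vcomp (L.cell (D.hcomp α β h)) (S.laxInv m' n')
      = E.vcomp (S.laxInv m n)
        (E.hcomp (L.cell α) (L.cell β) (by rw [right_cell, left_cell, h])) := by
  rw [← S.laxInv_laxator_assoc m n (E.vcomp (L.cell (D.hcomp α β h)) _),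
    ← E.vcomp_assoc (L.laxator m n), ← L.laxator_natural, E.vcomp_assoc, S.laxator_laxInv,
    E.vcomp_id]

theorem laxInv_natural_assoc {x y z x' y' z' : D.Obj} {m : D.Pro x y} {n : D.Pro y z}
    {m' : D.Pro x' y'} {n' : D.Pro y' z'} (α : D.Cell m m') (β : D.Cell n n')
    (h : D.right α = D.left β) {p q : E.Obj} {K : E.Pro p q}
    (γ : E.Cell (E.comp (L.pro m') (L.pro n')) K) :
    E.vcomp (L.cell (D.hcomp α β h)) (E.vcomp (S.laxInv m' n') γ)
      = E.vcomp (S.laxInv m n)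
        (E.vcomp (E.hcomp (L.cell α) (L.cell β) (by rw [right_cell, left_cell, h])) γ) := by
  rw [← E.vcomp_assoc, S.laxInv_natural, E.vcomp_assoc]

theorem unitInv_natural {x x' : D.Obj} (f : x ⟶ x') :
    E.vcomp (L.cell (D.hid f)) (S.unitInv x') = E.vcomp (S.unitInv x) (E.hid (L.map f)) := by
  rw [← E.id_vcomp (L.cell (D.hid f)), ← S.unitInv_unitor, E.vcomp_assoc, E.vcomp_assoc,
    ← E.vcomp_assoc (L.unitor x), ← L.unitor_natural, E.vcomp_assoc, S.unitor_unitInv,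
    E.vcomp_id]

/-- Both sides are obtained by inverting the comparison cells in the associativity axiom of `L`. -/
theorem coassociativity {x y z p : D.Obj} (m : D.Pro x y) (n : D.Pro y z) (k : D.Pro z p) :
    E.vcomp (S.laxInv (D.comp m n) k)
      (E.vcomp (E.hcomp (S.laxInv m n) (E.idc (L.pro k)) (by simp))
        (E.assoc (L.pro m) (L.pro n) (L.pro k)))
      = E.vcomp (L.cell (D.assoc m n k)) (E.vcomp (S.laxInv m (D.comp n k))
        (E.hcomp (E.idc (L.pro m)) (S.laxInv n k) (by simp))) := by
  -- Interchange shows that whiskering by an identity preserves the inverse pairs, so whiskered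
  -- comparisons cancel too.
  have e₁ := E.hcomp_vcomp (S.laxInv m n) (E.idc (L.pro k)) (L.laxator m n) (E.idc (L.pro k))
    (by simp) (by simp)
  have e₂ := E.hcomp_vcomp (E.idc (L.pro m)) (L.laxator n k) (E.idc (L.pro m)) (S.laxInv n k)
    (by simp) (by simp)
  simp only [S.laxInv_laxator, S.laxator_laxInv, E.vcomp_id, E.hcomp_idc] at e₁ e₂
  -- The associativity axiom is sandwiched between the inverse comparisons of its source and of its
  -- target; what remains is cancellation.
  have e₃ := congrArg (fun γ => E.vcomp (S.laxInv (D.comp m n) k)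
    (E.vcomp (E.hcomp (S.laxInv m n) (E.idc (L.pro k)) (by simp))
      (E.vcomp γ (E.vcomp (S.laxInv m (D.comp n k))
        (E.hcomp (E.idc (L.pro m)) (S.laxInv n k) (by simp)))))) (L.associativity m n k)
  simp only [E.vcomp_assoc, S.laxator_laxInv_assoc, ← e₂, E.vcomp_id] at e₃
  rw [← e₃, ← E.vcomp_assoc (E.hcomp (S.laxInv m n) _ _) (E.hcomp (L.laxator m n) _ _), ← e₁,
    E.id_vcomp, S.laxInv_laxator_assoc]

theorem left_counitality {x y : D.Obj} (m : D.Pro x y) :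
    E.vcomp (S.laxInv (D.unit x) m) (E.vcomp
        (E.hcomp (S.unitInv x) (E.idc (L.pro m)) (by simp)) (E.lunit (L.pro m)))
      = L.cell (D.lunit m) := by
  have e₁ := E.hcomp_vcomp (S.unitInv x) (E.idc (L.pro m)) (L.unitor x) (E.idc (L.pro m))
    (by simp) (by simp)
  simp only [S.unitInv_unitor, E.vcomp_id, E.hcomp_idc] at e₁
  rw [← L.left_unitality, ← E.vcomp_assoc (E.hcomp (S.unitInv x) _ _), ← e₁, E.id_vcomp,
    S.laxInv_laxator_assoc]

theorem right_counitality {x y : D.Obj} (m : D.Pro x y) :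
    E.vcomp (S.laxInv m (D.unit y)) (E.vcomp
        (E.hcomp (E.idc (L.pro m)) (S.unitInv y) (by simp)) (E.runit (L.pro m)))
      = L.cell (D.runit m) := by
  have e₁ := E.hcomp_vcomp (E.idc (L.pro m)) (S.unitInv y) (E.idc (L.pro m)) (L.unitor y)
    (by simp) (by simp)
  simp only [S.unitInv_unitor, E.vcomp_id, E.hcomp_idc] at e₁
  rw [← L.right_unitality, ← E.vcomp_assoc (E.hcomp _ (S.unitInv y) _), ← e₁, E.id_vcomp,
    S.laxInv_laxator_assoc]

end StrongData

/-! ### The lax right adjoint determined by universal cells. -/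

namespace UniversalCells

variable (U : L.UniversalCells)

attribute [simp] lift_fac left_εCell right_εCell liftCell_fac

@[simp]
-- The boundary of a lifted cell need not be assumed: taking left boundaries in the factorization
-- gives the equation that characterizes `lift`.
theorem left_liftCell {x y : D.Obj} {m : D.Pro x y} {X Y : E.Obj} {M : E.Pro X Y}
    (γ : E.Cell (L.pro m) M) : D.left (U.liftCell γ) = U.lift (E.left γ) :=
  U.hom_ext (by
    rw [U.lift_fac]
    -- With `liftCell_fac` as a simp rule the factorization would collapse to a triviality before
    -- its boundary is computed.
    simpa [-liftCell_fac] using congrArg E.left (U.liftCell_fac γ))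

@[simp]
theorem right_liftCell {x y : D.Obj} {m : D.Pro x y} {X Y : E.Obj} {M : E.Pro X Y}
    (γ : E.Cell (L.pro m) M) : D.right (U.liftCell γ) = U.lift (E.right γ) :=
  U.hom_ext (by
    rw [U.lift_fac]
    simpa [-liftCell_fac] using congrArg E.right (U.liftCell_fac γ))

@[simp]
theorem lift_ε (X : E.Obj) : U.lift (U.ε X) = 𝟙 _ :=
  U.hom_ext (by simp)

theorem lift_fac_assoc {x : D.Obj} {X Y : E.Obj} (f : L.obj x ⟶ X) (g : X ⟶ Y) :
    L.map (U.lift f) ≫ U.ε X ≫ g = f ≫ g := by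
  rw [← Category.assoc, U.lift_fac]

theorem liftCell_fac_assoc {x y : D.Obj} {m : D.Pro x y} {X Y : E.Obj} {M : E.Pro X Y}
    (γ : E.Cell (L.pro m) M) {p q : E.Obj} {K : E.Pro p q} (δ : E.Cell M K) :
    E.vcomp (L.cell (U.liftCell γ)) (E.vcomp (U.εCell M) δ) = E.vcomp γ δ := by
  rw [← E.vcomp_assoc, U.liftCell_fac]

variable (S : L.StrongData)

/-- The lax right adjoint of a strong double functor given by universal arrows and cells. -/
def rightAdjoint : LaxDblFunctor E D where
  obj := U.obj
  map f := U.lift (U.ε _ ≫ f)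
  map_id X := by simp
  map_comp f g := U.hom_ext (by
    rw [L.map_comp, Category.assoc, U.lift_fac, U.lift_fac, U.lift_fac_assoc,
      Category.assoc])
  pro := U.pro
  cell α := U.liftCell (E.vcomp (U.εCell _) α)
  left_cell α := by simp
  right_cell α := by simp
  cell_idc M := U.cell_ext (by simp)
  cell_vcomp α β := U.cell_ext (by simp [U.liftCell_fac_assoc])
  laxator M N := U.liftCell (E.vcomp (S.laxInv _ _) (E.hcomp (U.εCell M) (U.εCell N) (by simp)))
  left_laxator M N := by simp
  right_laxator M N := by simp
  laxator_natural α β h := by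
    refine U.cell_ext ?_
    simp only [L.cell_vcomp, E.vcomp_assoc, liftCell_fac, U.liftCell_fac_assoc,
      S.laxInv_natural_assoc, ← E.hcomp_vcomp]
  unitor X := U.liftCell (E.vcomp (S.unitInv _) (E.hid (U.ε X)))
  left_unitor X := by simp
  right_unitor X := by simp
  unitor_natural f := by
    refine U.cell_ext ?_
    simp only [L.cell_vcomp, E.vcomp_assoc, liftCell_fac, U.liftCell_fac_assoc, ← E.hid_comp]
    rw [← E.vcomp_assoc, S.unitInv_natural, E.vcomp_assoc, ← E.hid_comp, U.lift_fac]
  associativity M N K := by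
    -- Interchange separates the inverse comparisons of `L` from the universal cells; afterwards the
    -- associator of `E` moves past the latter by naturality.
    have e₁ := E.hcomp_vcomp (S.laxInv (U.pro M) (U.pro N)) (E.idc (L.pro (U.pro K)))
      (E.hcomp (U.εCell M) (U.εCell N) (by simp)) (U.εCell K) (by simp) (by simp)
    have e₂ := E.hcomp_vcomp (E.idc (L.pro (U.pro M))) (S.laxInv (U.pro N) (U.pro K))
      (U.εCell M) (E.hcomp (U.εCell N) (U.εCell K) (by simp)) (by simp) (by simp)
    refine U.cell_ext ?_
    simp only [L.cell_vcomp, E.vcomp_assoc, liftCell_fac, U.liftCell_fac_assoc,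
      S.laxInv_natural_assoc, L.cell_idc]
    rw [← E.vcomp_assoc (E.hcomp _ _ _) (E.hcomp _ _ _) (E.assoc _ _ _)]
    simp only [← E.hcomp_vcomp, liftCell_fac]
    rw [e₁, e₂, E.vcomp_assoc, E.assoc_natural]
    -- Only coassociativity of `L` is left, followed by the triple composite of universal cells.
    have e₃ := congrArg (fun γ => E.vcomp γ
      (E.hcomp (U.εCell M) (E.hcomp (U.εCell N) (U.εCell K) (by simp)) (by simp)))
      (S.coassociativity (U.pro M) (U.pro N) (U.pro K))
    simpa only [E.vcomp_assoc] using e₃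
  left_unitality {X Y} M := by
    have e₁ := E.hcomp_vcomp (S.unitInv (U.obj X)) (E.idc (L.pro (U.pro M)))
      (E.hid (U.ε X)) (U.εCell M) (by simp) (by simp)
    -- The unitor of `E` moves past the universal cell. The boundary is then rewritten as `U.ε X`,
    -- to match the identity cell produced by the unit comparison.
    have e₂ := E.lunit_natural (U.εCell M)
    simp only [U.left_εCell] at e₂
    have e₃ := congrArg (fun γ => E.vcomp γ (U.εCell M)) (S.left_counitality (U.pro M))
    refine U.cell_ext ?_
    simp only [L.cell_vcomp, E.vcomp_assoc, liftCell_fac, U.liftCell_fac_assoc,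
      S.laxInv_natural_assoc, L.cell_idc]
    rw [← E.vcomp_assoc (E.hcomp _ _ _) (E.hcomp _ _ _) (E.lunit _)]
    simp only [← E.hcomp_vcomp, liftCell_fac]
    rw [e₁, E.vcomp_assoc, e₂]
    simpa only [E.vcomp_assoc] using e₃
  right_unitality {X Y} M := by
    have e₁ := E.hcomp_vcomp (E.idc (L.pro (U.pro M))) (S.unitInv (U.obj Y))
      (U.εCell M) (E.hid (U.ε Y)) (by simp) (by simp)
    have e₂ := E.runit_natural (U.εCell M)
    simp only [U.right_εCell] at e₂
    have e₃ := congrArg (fun γ => E.vcomp γ (U.εCell M)) (S.right_counitality (U.pro M))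
    refine U.cell_ext ?_
    simp only [L.cell_vcomp, E.vcomp_assoc, liftCell_fac, U.liftCell_fac_assoc,
      S.laxInv_natural_assoc, L.cell_idc]
    rw [← E.vcomp_assoc (E.hcomp _ _ _) (E.hcomp _ _ _) (E.runit _)]
    simp only [← E.hcomp_vcomp, liftCell_fac]
    rw [e₁, E.vcomp_assoc, e₂]
    simpa only [E.vcomp_assoc] using e₃

/-- The adjunction between a strong double functor and the lax double functor given by universal
arrows and cells. -/
def adjunction : LaxDblAdjunction L (U.rightAdjoint S) where
  unit :=
    { app := fun x => U.lift (𝟙 (L.obj x))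
      naturality := fun f => U.hom_ext (by
        simp only [rightAdjoint, LaxDblFunctor.comp, LaxDblFunctor.id, L.map_comp,
          Category.assoc, lift_fac, Category.comp_id, U.lift_fac_assoc, Category.id_comp])
      cellApp := fun m => U.liftCell (E.idc (L.pro m))
      left_cellApp := fun m => (U.left_liftCell _).trans (congrArg U.lift (E.left_idc _))
      right_cellApp := fun m => (U.right_liftCell _).trans (congrArg U.lift (E.right_idc _))
      cell_naturality := fun α => U.cell_ext (by
        simp only [rightAdjoint, LaxDblFunctor.comp, LaxDblFunctor.id, L.cell_vcomp,
          E.vcomp_assoc, liftCell_fac, U.liftCell_fac_assoc, E.vcomp_id, E.id_vcomp])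
      comp_compat := fun m n => U.cell_ext (by
        simp only [rightAdjoint, LaxDblFunctor.comp, LaxDblFunctor.id, L.cell_vcomp,
          E.vcomp_assoc, liftCell_fac, U.liftCell_fac_assoc, L.cell_idc, E.id_vcomp,
          S.laxInv_natural_assoc]
        rw [← E.vcomp_assoc (E.hcomp _ _ _) (E.hcomp _ _ _), ← E.hcomp_vcomp]
        -- The unit uses `laxInv` followed by `laxator`; compatibility of the counit uses the
        -- opposite order.
        simp only [liftCell_fac, E.hcomp_idc, E.id_vcomp, S.laxInv_laxator])
      unit_compat := fun x => U.cell_ext (by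
        simp only [rightAdjoint, LaxDblFunctor.comp, LaxDblFunctor.id, L.cell_vcomp,
          E.vcomp_assoc, liftCell_fac, U.liftCell_fac_assoc, L.cell_idc, E.id_vcomp]
        rw [← E.vcomp_assoc, S.unitInv_natural, E.vcomp_assoc, ← E.vcomp_assoc (E.hid _),
          ← E.hid_comp, U.lift_fac, E.hid_id, E.id_vcomp, S.unitInv_unitor]) }
  counit :=
    { app := U.ε
      naturality := fun f => U.lift_fac _
      cellApp := U.εCell
      left_cellApp := U.left_εCell
      right_cellApp := U.right_εCell
      cell_naturality := fun α => U.liftCell_fac _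
      comp_compat := fun M N => by
        simp only [rightAdjoint, LaxDblFunctor.comp, LaxDblFunctor.id, E.vcomp_assoc,
          liftCell_fac, S.laxator_laxInv_assoc, E.vcomp_id]
      unit_compat := fun X => by
        simp only [rightAdjoint, LaxDblFunctor.comp, LaxDblFunctor.id, E.vcomp_assoc,
          liftCell_fac, S.unitor_unitInv_assoc, E.vcomp_id] }
  left_triangle x := U.lift_fac _
  left_triangle_cell m := U.liftCell_fac _
  right_triangle X := U.hom_ext (by
    simp only [rightAdjoint, LaxDblFunctor.comp, LaxDblFunctor.id, L.map_comp,
      Category.assoc, lift_fac, U.lift_fac_assoc, Category.id_comp, L.map_id])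
  right_triangle_cell M := U.cell_ext (by
    simp only [rightAdjoint, LaxDblFunctor.comp, LaxDblFunctor.id, L.cell_vcomp,
      E.vcomp_assoc, liftCell_fac, U.liftCell_fac_assoc, E.id_vcomp, L.cell_idc])

end UniversalCells

end LaxDblFunctor

/-! ### Invertible comparisons of the diagonal. -/

/-- The diagonal double functor is strong. -/
def diagonalStrongData (D : DblCat.{v₁, v₂, u₁, u₂}) : (diagonal.{t} D).StrongData where
  laxInv m n :=
    { left := 𝟙 _
      right := 𝟙 _
      ix := fun _ => PUnit.unit
      ix_l := fun _ => rfl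
      ix_r := fun _ => rfl
      cell := fun _ _ _ _ _ => D.idc (D.comp m n)
      left_cell := fun _ _ _ _ _ => D.left_idc _
      right_cell := fun _ _ _ _ _ => D.right_idc _ }
  laxator_laxInv _ _ := FinFamOp.Cell.ext' (Category.id_comp _) (Category.id_comp _)
    (fun _ => rfl) fun _ => heq_of_eq (D.id_vcomp _)
  laxInv_laxator _ _ := FinFamOp.Cell.ext' (Category.id_comp _) (Category.id_comp _)
    (fun _ => rfl) fun _ => heq_of_eq (D.id_vcomp _)
  unitInv x :=
    { left := 𝟙 _
      right := 𝟙 _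
      ix := fun _ => PUnit.unit
      ix_l := fun _ => rfl
      ix_r := fun _ => rfl
      cell := fun _ _ _ _ _ => D.idc (D.unit x)
      left_cell := fun _ _ _ _ _ => D.left_idc _
      right_cell := fun _ _ _ _ _ => D.right_idc _ }
  unitor_unitInv _ := FinFamOp.Cell.ext' (Category.id_comp _) (Category.id_comp _)
    (fun _ => rfl) fun _ => heq_of_eq (D.id_vcomp _)
  unitInv_unitor _ := FinFamOp.Cell.ext' (Category.id_comp _) (Category.id_comp _)
    (fun _ => rfl) fun _ => heq_of_eq (D.id_vcomp _)

/-! ### Finite products of sets and of matrices as universal cells. -/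

noncomputable section

namespace VMat

variable {V : Type u} [Category.{v} V]

/-- The components of a cell with both boundaries replaced by equal functions. -/
def Cell.appOn {X Y X' Y' : Type w} {M : X → Y → V} {M' : X' → Y' → V} (α : Cell M M')
    {f : X ⟶ X'} {g : Y ⟶ Y'} (h : α.left = f) (h' : α.right = g) (x : X) (y : Y) :
    M x y ⟶ M' (f x) (g y) := by
  subst h h'
  exact α.app x y

/-- The components of a cell of families have the prescribed boundaries only up to a propositional
equality. `appOn` transports along it, and this lemma undoes the transport in the factorization
property of `universalCells`. -/
theorem Cell.appOn_heq {X Y X' Y' : Type w} {M : X → Y → V} {M' : X' → Y' → V} (α : Cell M M')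
    {f : X ⟶ X'} {g : Y ⟶ Y'} (h : α.left = f) (h' : α.right = g) (x : X) (y : Y) :
    HEq (α.appOn h h' x y) (α.app x y) := by
  subst h h'
  rfl

variable [MonoidalCategory V] [HasCoproducts.{w} V] [MonoidalDistributive.{w} V]
  [HasFiniteProducts V]

/-- A function as an arrow of the double category of matrices. -/
def ofFun {A B : Type w} (f : A → B) : @Quiver.Hom (VMat.{w} V).Obj _ A B := TypeCat.ofHom f

/-- An arrow of the double category of matrices as a function. -/
def toFun {A B : Type w} (f : @Quiver.Hom (VMat.{w} V).Obj _ A B) : A → B :=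
  show A ⟶ B from f

/-- The product of a finite family of matrices. -/
def piPro {X Y : FinFamOp.Fam.{w} (VMat.{w} V)} (M : FinFamOp.Pro X Y) (x : ∀ i, X.x i)
    (y : ∀ j, Y.x j) : V :=
  ∏ᶜ fun a => M.m a rfl rfl (x (M.l a)) (y (M.r a))

/-- The projections of the product of a finite family of matrices. -/
def piProπ {X Y : FinFamOp.Fam.{w} (VMat.{w} V)} (M : FinFamOp.Pro X Y) (a : M.A) {i : X.I}
    {j : Y.I} (hi : M.l a = i) (hj : M.r a = j) (x : ∀ i, X.x i) (y : ∀ j, Y.x j) :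
    piPro M x y ⟶ M.m a hi hj (x i) (y j) := by
  subst hi hj
  exact Pi.π (fun a => M.m a rfl rfl (x (M.l a)) (y (M.r a))) a

/-- The arrow into a product of matrices with given projections. -/
def piLift {X Y : FinFamOp.Fam.{w} (VMat.{w} V)} (M : FinFamOp.Pro X Y) {T : V}
    {x : ∀ i, X.x i} {y : ∀ j, Y.x j}
    (f : ∀ a, T ⟶ M.m a rfl rfl (x (M.l a)) (y (M.r a))) : T ⟶ piPro M x y :=
  Pi.lift f

theorem piLift_π {X Y : FinFamOp.Fam.{w} (VMat.{w} V)} (M : FinFamOp.Pro X Y) {T : V}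
    {x : ∀ i, X.x i} {y : ∀ j, Y.x j}
    (f : ∀ a, T ⟶ M.m a rfl rfl (x (M.l a)) (y (M.r a))) (a : M.A) :
    piLift M f ≫ piProπ M a rfl rfl x y = f a :=
  Pi.lift_π _ _

theorem piPro_ext {X Y : FinFamOp.Fam.{w} (VMat.{w} V)} (M : FinFamOp.Pro X Y) {T : V}
    {x : ∀ i, X.x i} {y : ∀ j, Y.x j} {f g : T ⟶ piPro M x y}
    (h : ∀ a, f ≫ piProπ M a rfl rfl x y = g ≫ piProπ M a rfl rfl x y) : f = g :=
  Pi.hom_ext _ _ h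

/-- Finite products of sets and of matrices provide universal arrows and cells from the diagonal
double functor. -/
def universalCells (V : Type u) [Category.{v} V] [MonoidalCategory V] [HasCoproducts.{w} V]
    [MonoidalDistributive.{w} V] [HasFiniteProducts V] :
    (diagonal.{w} (VMat.{w} V)).UniversalCells where
  obj X := ∀ i, X.x i
  ε X := ⟨fun _ => PUnit.unit, fun i => ofFun fun x => x i⟩
  lift f := ofFun fun t i => toFun (f.hom i) t
  lift_fac f := rfl
  hom_ext {x X f g} h := by
    -- The type of `k.hom i` mentions the index map of `k`, so a heterogeneous equality comes first.
    -- It is homogeneous because the source family is constant.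
    have h' : ∀ i t, toFun f t i = toFun g t i := fun i t => congrArg (fun k => toFun k t)
      (eq_of_heq (congr_arg_heq (fun k : FinFamOp.Hom _ _ => k.hom i) h))
    exact TypeCat.homEquiv.injective (funext fun t => funext fun i => h' i t)
  pro M := piPro M
  εCell {X Y} M :=
    { left := ⟨fun _ => PUnit.unit, fun i => ofFun fun x => x i⟩
      right := ⟨fun _ => PUnit.unit, fun i => ofFun fun x => x i⟩
      ix := fun _ => PUnit.unit
      ix_l := fun _ => rfl
      ix_r := fun _ => rfl
      cell := fun b k l hk hl => ⟨TypeCat.ofHom fun x => x k, TypeCat.ofHom fun y => y l,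
        piProπ M b hk hl⟩
      left_cell := fun _ _ _ _ _ => rfl
      right_cell := fun _ _ _ _ _ => rfl }
  left_εCell M := rfl
  right_εCell M := rfl
  liftCell {x y m X Y M} γ :=
    { left := TypeCat.ofHom fun t i => toFun (γ.left.hom i) t
      right := TypeCat.ofHom fun t i => toFun (γ.right.hom i) t
      app := fun t s => piLift M fun a => (γ.cell a rfl rfl).appOn (γ.left_cell a rfl rfl)
        (γ.right_cell a rfl rfl) t s }
  liftCell_fac {x y m X Y M} γ := by
    refine FinFamOp.Cell.ext' rfl rfl (fun _ => rfl) fun a => heq_of_eq ?_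
    refine Cell.ext' (γ.left_cell a rfl rfl).symm (γ.right_cell a rfl rfl).symm fun t s => ?_
    refine HEq.trans (heq_of_eq ?_) ((γ.cell a rfl rfl).appOn_heq (γ.left_cell a rfl rfl)
        (γ.right_cell a rfl rfl) t s)
    exact piLift_π M _ a
  cell_ext {x y m X Y M α β} h := by
    obtain ⟨l, r, p⟩ := α
    obtain ⟨l', r', q⟩ := β
    have hl : ∀ i t, toFun (V := V) l t i = toFun (V := V) l' t i := fun i t =>
      congrArg (fun k : FinFamOp.Cell (FinFamOp.singlePro m) M => toFun (k.left.hom i) t) h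
    have hr : ∀ i t, toFun (V := V) r t i = toFun (V := V) r' t i := fun i t =>
      congrArg (fun k : FinFamOp.Cell (FinFamOp.singlePro m) M => toFun (k.right.hom i) t) h
    obtain rfl : l = l' := TypeCat.homEquiv.injective (funext fun t => funext fun i => hl i t)
    obtain rfl : r = r' := TypeCat.homEquiv.injective (funext fun t => funext fun i => hr i t)
    refine Cell.ext' rfl rfl fun t s => heq_of_eq (piPro_ext M fun a => ?_)
    -- Since `singlePro m` is a constant family, the type of the component at `a` does not depend on
    -- `k`, and the equation `h` can be evaluated there.
    let cellAt (k : FinFamOp.Cell (FinFamOp.singlePro m) M) :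
        (VMat.{w} V).Cell m (M.m a (i := M.l a) (j := M.r a) rfl rfl) :=
      k.cell a rfl rfl
    have h₁ : cellAt _ = cellAt _ := congrArg cellAt h
    exact eq_of_heq (congr_arg_heq (fun k => VMat.Cell.app k t s) h₁)

end VMat

end

/-! ### Coproduct cofans and product cones under isomorphism and reindexing. -/

section

variable {V : Type u} [Category.{v} V] [HasCoproducts.{w} V]

/-- Whether a cofan is a coproduct is invariant under isomorphisms and reindexing. -/
theorem isIso_sigmaDesc_iff_of_equiv {S S' : Type w} (σ : S ≃ S') {T : S → V} {T' : S' → V}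
    {W W' : V} (c : ∀ s, T s ⟶ W) (c' : ∀ s, T' s ⟶ W') (i : ∀ s, T s ⟶ T' (σ s))
    (hi : ∀ s, IsIso (i s)) (p : W ⟶ W') (hp : IsIso p) (h : ∀ s, c s ≫ p = i s ≫ c' (σ s)) :
    IsIso (Sigma.desc c) ↔ IsIso (Sigma.desc c') := by
  have e : Sigma.desc c ≫ p
      = (Sigma.whiskerEquiv σ fun s => (asIso (i s)).symm).hom ≫ Sigma.desc c' := by
    refine Sigma.hom_ext _ _ fun s => ?_
    simp [h]
  rw [← isIso_comp_right_iff (Sigma.desc c) p, e, isIso_comp_left_iff]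

end

theorem isIso_sigmaDesc_of_unique {V : Type u} [Category.{v} V] {S : Type w} [Unique S]
    [HasCoproductsOfShape S V] {T : S → V} {W : V}
    (c : ∀ s, T s ⟶ W) [IsIso (c default)] : IsIso (Sigma.desc c) := by
  refine ⟨inv (c default) ≫ Sigma.ι T default, Sigma.hom_ext _ _ fun s => ?_, by simp⟩
  obtain rfl := Unique.eq_default s
  simp

section

variable {V : Type u} [Category.{v} V] [HasFiniteProducts V]

theorem isIso_piMap {J : Type w} [Finite J] {F G : J → V} (f : ∀ j, F j ⟶ G j)
    (hf : ∀ j, IsIso (f j)) : IsIso (Limits.Pi.map f) :=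
  ⟨Limits.Pi.map fun j => inv (f j), Pi.hom_ext _ _ fun j => by simp,
    Pi.hom_ext _ _ fun j => by simp⟩

/-- Stated separately so that it can be used as a term where the families agree with those of the
double category only by unfolding. -/
theorem piLift_piMap_π {J : Type w} [Finite J] {T : V} {F G : J → V} (f : ∀ j, T ⟶ F j)
    (g : ∀ j, F j ⟶ G j) (j : J) : (Pi.lift f ≫ Limits.Pi.map g) ≫ Pi.π G j = f j ≫ g j := by
  simp

theorem isIso_piReindex {J J' : Type w} [Finite J] [Finite J'] (e : J' ≃ J) (F : J → V) :
    IsIso (Pi.lift fun j' => Pi.π F (e j')) := by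
  have : (Pi.lift fun j' => Pi.π F (e j')) = (Pi.reindex e F).inv :=
    Pi.hom_ext _ _ fun j' => (Pi.lift_π _ _).trans (Pi.reindex_inv_π e F j').symm
  rw [this]
  exact Iso.isIso_inv _

/-- Naturality of reindexing, needed when the distributive law is transported along a bijection of
index sets. -/
theorem piMap_reindex {J J' : Type w} [Finite J] [Finite J'] (e : J' ≃ J) {F G : J → V}
    (g : ∀ j, F j ⟶ G j) :
    Limits.Pi.map g ≫ Pi.lift (fun j' => Pi.π G (e j'))
      = Pi.lift (fun j' => Pi.π F (e j')) ≫ Limits.Pi.map fun j' => g (e j') :=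
  Pi.hom_ext _ _ fun j' => by simp

/-- A family of arrows is a product cone if it is so after reindexing along a bijection. -/
theorem isIso_piLift_of_equiv {J J' : Type w} [Finite J] [Finite J'] (e : J' ≃ J) {T : V}
    {F : J → V} (f : ∀ j, T ⟶ F j) (h : IsIso (Pi.lift fun j' => f (e j'))) :
    IsIso (Pi.lift f) := by
  have := isIso_piReindex e F
  have h' : Pi.lift f ≫ Pi.lift (fun j' => Pi.π F (e j')) = Pi.lift fun j' => f (e j') :=
    Pi.hom_ext _ _ fun j' => by simp
  rwa [← h', isIso_comp_right_iff] at h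

end

/-! ### Binary tensor products of cones and of cofans. -/

section

variable {V : Type u} [Category.{v} V] [CartesianMonoidalCategory V]

open CartesianMonoidalCategory

/-- The canonical arrow from a binary product to a product indexed by `Option J`. -/
noncomputable def optionLift {J : Type w} [Finite J] (F : Option J → V) :
    F none ⊗ (∏ᶜ fun j => F (some j)) ⟶ ∏ᶜ F :=
  Pi.lift fun o => match o with
    | none => fst _ _
    | some j => snd _ _ ≫ Pi.π (fun j => F (some j)) j

@[simp]
theorem optionLift_π_none {J : Type w} [Finite J] (F : Option J → V) :
    optionLift F ≫ Pi.π F none = fst _ _ :=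
  Pi.lift_π _ _

@[simp]
theorem optionLift_π_some {J : Type w} [Finite J] (F : Option J → V) (j : J) :
    optionLift F ≫ Pi.π F (some j) = snd _ _ ≫ Pi.π (fun j => F (some j)) j :=
  Pi.lift_π _ _

instance isIso_optionLift {J : Type w} [Finite J] (F : Option J → V) : IsIso (optionLift F) := by
  refine ⟨lift (Pi.π F none) (Pi.lift fun j => Pi.π F (some j)), ?_, ?_⟩
  · refine CartesianMonoidalCategory.hom_ext _ _ (by simp) (Pi.hom_ext _ _ fun j => by simp)
  · refine Pi.hom_ext _ _ fun o => ?_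
    cases o <;> simp

theorem optionLift_natural {J : Type w} [Finite J] {F G : Option J → V} (g : ∀ o, F o ⟶ G o) :
    (g none ⊗ₘ Limits.Pi.map fun j => g (some j)) ≫ optionLift G
      = optionLift F ≫ Limits.Pi.map g := by
  refine Pi.hom_ext _ _ fun o => ?_
  cases o with
  | none => simp [← Category.assoc (optionLift F)]
  | some j => simp [← Category.assoc (optionLift F)]

/-- The tensor product of two product cones of the same shape is a product cone. -/
theorem isIso_piLift_tensorHom {J : Type w} [Finite J] {S T : V} {F G : J → V}
    (f : ∀ j, S ⟶ F j) (g : ∀ j, T ⟶ G j) (hf : IsIso (Pi.lift f)) (hg : IsIso (Pi.lift g)) :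
    IsIso (Pi.lift fun j => f j ⊗ₘ g j) := by
  -- The universal case says that products commute with binary products: the inverse pairs the two
  -- families of projections. The general case follows by precomposing with a tensor product of
  -- isomorphisms.
  have h : IsIso (Pi.lift fun j => Pi.π F j ⊗ₘ Pi.π G j) := by
    refine ⟨lift (Pi.lift fun j => Pi.π _ j ≫ fst _ _) (Pi.lift fun j => Pi.π _ j ≫ snd _ _),
      ?_, ?_⟩
    · refine CartesianMonoidalCategory.hom_ext _ _ (Pi.hom_ext _ _ fun j => ?_)
        (Pi.hom_ext _ _ fun j => ?_) <;> simp
    · refine Pi.hom_ext _ _ fun j => CartesianMonoidalCategory.hom_ext _ _ ?_ ?_ <;> simp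
  have e : (Pi.lift fun j => f j ⊗ₘ g j)
      = (Pi.lift f ⊗ₘ Pi.lift g) ≫ Pi.lift fun j => Pi.π F j ⊗ₘ Pi.π G j := by
    refine Pi.hom_ext _ _ fun j => ?_
    simp
  rw [e]
  infer_instance

end

section

variable {V : Type u} [Category.{v} V] [MonoidalCategory V] [HasCoproducts.{w} V]
  [MonoidalDistributive.{w} V]

/-- The tensor product of two coproduct cofans is a coproduct cofan. -/
theorem isIso_sigmaDesc_tensorHom {S T : Type w} {A : S → V} {B : T → V} {W U : V}
    (c : ∀ s, A s ⟶ W) (d : ∀ t, B t ⟶ U) (hc : IsIso (Sigma.desc c))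
    (hd : IsIso (Sigma.desc d)) : IsIso (Sigma.desc fun p : S × T => c p.1 ⊗ₘ d p.2) := by
  have h : IsIso (Sigma.desc fun p : S × T => Sigma.ι A p.1 ⊗ₘ Sigma.ι B p.2) := by
    -- For the universal cofans the inverse is defined by distributing over one factor and then over
    -- the other. General cofans differ from these by a tensor product of isomorphisms.
    refine ⟨VMat.descR _ fun s => VMat.descL _ fun t =>
      Sigma.ι (fun p : S × T => A p.1 ⊗ B p.2) (s, t), ?_, ?_⟩
    · refine Sigma.hom_ext _ _ fun p => ?_
      rw [Sigma.ι_desc_assoc, MonoidalCategory.tensorHom_def', Category.assoc, VMat.ι_descR,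
        VMat.ι_descL, Category.comp_id]
    · refine VMat.hom_extR fun s => VMat.hom_extL fun t => ?_
      rw [← Category.assoc (Sigma.ι A s ▷ _), VMat.ι_descR, ← Category.assoc, VMat.ι_descL,
        Sigma.ι_desc, Category.comp_id, MonoidalCategory.tensorHom_def']
  have e : (Sigma.desc fun p : S × T => c p.1 ⊗ₘ d p.2)
      = (Sigma.desc fun p : S × T => Sigma.ι A p.1 ⊗ₘ Sigma.ι B p.2) ≫
        (Sigma.desc c ⊗ₘ Sigma.desc d) := by
    refine Sigma.hom_ext _ _ fun p => ?_
    simp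
  rw [e]
  infer_instance

end

/-! ### The finite distributive law. -/

/-- In a distributive category, finite products of coproducts are coproducts of finite products. -/
theorem isIso_sigmaDesc_piMap {V : Type u} [Category.{v} V] [CartesianMonoidalCategory V]
    [HasCoproducts.{w} V] [DistributiveCategory.{w} V] (J : Type w)
    [Finite J] (K : J → Type w) (Z : ∀ j, K j → V) :
    IsIso (Sigma.desc fun f : ∀ j, K j => Limits.Pi.map fun j => Sigma.ι (Z j) (f j)) := by
  refine Finite.induction_empty_option (P := fun J : Type w => ∀ [Finite J] (K : J → Type w)
    (Z : ∀ j, K j → V),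
      IsIso (Sigma.desc fun f : ∀ j, K j => Limits.Pi.map fun j => Sigma.ι (Z j) (f j)))
    ?_ ?_ ?_ J K Z
  · intro α β e ih _ K Z
    have := Finite.of_equiv _ e.symm
    -- Precomposition with `e` identifies choice functions over `β` with those over `α`, and
    -- reindexing identifies the products.
    exact (isIso_sigmaDesc_iff_of_equiv (Equiv.piCongrLeft K e).symm _ _
      (fun f => Pi.lift fun a => Pi.π (fun b => Z b (f b)) (e a)) (fun f => isIso_piReindex e _)
      (Pi.lift fun a => Pi.π (fun b => ∐ Z b) (e a)) (isIso_piReindex e _)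
      fun f => piMap_reindex e _).2 (ih (fun a => K (e a)) (fun a => Z (e a)))
  · intro _ K Z
    -- Over the empty set there is exactly one choice function, and the single leg of the cofan is a
    -- map between empty products.
    have := isIso_piMap (fun j : PEmpty.{w+1} => Sigma.ι (Z j) ((default : ∀ j, K j) j))
      fun j => j.elim
    exact isIso_sigmaDesc_of_unique _
  · intro α _ ih _ K Z
    -- The cofan of the new factor is the universal one. Tensored with the cofan of the induction
    -- hypothesis, it becomes the required cofan after splitting a choice function into its value at
    -- `none` and the rest.
    have h : IsIso (Sigma.desc (Sigma.ι (Z none))) := by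
      have : Sigma.desc (Sigma.ι (Z none)) = 𝟙 _ := Sigma.hom_ext _ _ fun _ => by simp
      rw [this]
      infer_instance
    exact (isIso_sigmaDesc_iff_of_equiv Equiv.piOptionEquivProd.symm _ _
      (fun p => optionLift fun o => Z o (Equiv.piOptionEquivProd.symm p o))
      (fun p => isIso_optionLift _) (optionLift fun o => ∐ Z o) (isIso_optionLift _)
      fun p => optionLift_natural fun o => Sigma.ι (Z o) (Equiv.piOptionEquivProd.symm p o)).1
      (isIso_sigmaDesc_tensorHom (Sigma.ι (Z none))
        (fun f : ∀ a, K (some a) => Limits.Pi.map fun a => Sigma.ι (Z (some a)) (f a))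
        h (ih (fun a => K (some a)) (fun a => Z (some a))))

/-! ### Invertibility of the comparison cells for products of matrices. -/

noncomputable section

namespace VMat

/-- With identity boundaries, vertical composition is componentwise composition in `V`, so entrywise
inverses assemble into an inverse cell. -/
theorem isIsoCell {V : Type u} [Category.{v} V] [MonoidalCategory V] [HasCoproducts.{w} V]
    [MonoidalDistributive.{w} V] {X Y : Type w} {M M' : X → Y → V}
    (a : ∀ x y, M x y ⟶ M' x y) (h : ∀ x y, IsIso (a x y)) :
    (VMat.{w} V).IsIsoCell (⟨𝟙 X, 𝟙 Y, a⟩ : Cell M M') :=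
  ⟨(⟨𝟙 X, 𝟙 Y, fun x y => (h x y).out.choose⟩ : Cell M' M),
    Cell.ext' rfl rfl fun x y => heq_of_eq (h x y).out.choose_spec.1,
    Cell.ext' rfl rfl fun x y => heq_of_eq (h x y).out.choose_spec.2⟩

section

variable {V : Type u} [Category.{v} V] [MonoidalCategory V] [HasCoproducts.{w} V]
  [MonoidalDistributive.{w} V] [HasFiniteProducts V]

/-- The components of the composition comparison for products of matrices. -/
def piLaxator {X Y Z : FinFamOp.Fam.{w} (VMat.{w} V)} (M : FinFamOp.Pro X Y)
    (N : FinFamOp.Pro Y Z) (x : ∀ i, X.x i) (z : ∀ k, Z.x k) :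
    comp (piPro M) (piPro N) x z ⟶ piPro (FinFamOp.comp M N) x z :=
  compDesc fun y => piLift (FinFamOp.comp M N) fun p =>
    (piProπ M p.fst rfl p.hr x y ⊗ₘ piProπ N p.snd p.hl rfl y z) ≫
      compι (M.m p.fst rfl p.hr) (N.m p.snd p.hl rfl) (x (M.l p.fst)) (y p.mid) (z (N.r p.snd))

theorem compι_piLaxator {X Y Z : FinFamOp.Fam.{w} (VMat.{w} V)} (M : FinFamOp.Pro X Y)
    (N : FinFamOp.Pro Y Z) (x : ∀ i, X.x i) (y : ∀ j, Y.x j) (z : ∀ k, Z.x k)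
    (p : FinFamOp.Pullback M N) :
    compι (piPro M) (piPro N) x y z ≫ piLaxator M N x z ≫
      piProπ (FinFamOp.comp M N) p rfl rfl x z
      = (piProπ M p.fst rfl p.hr x y ⊗ₘ piProπ N p.snd p.hl rfl y z) ≫
      compι (M.m p.fst rfl p.hr) (N.m p.snd p.hl rfl) (x (M.l p.fst)) (y p.mid)
        (z (N.r p.snd)) :=
  (compι_desc_assoc _ y _).trans (piLift_π (FinFamOp.comp M N) _ p)

/-- By the universal property it suffices to compare projections, and then restrictions along the
coproduct injections. There both sides are a tensor product of two projections followed by an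
injection. -/
theorem rightAdjoint_laxator {X Y Z : FinFamOp.Fam.{w} (VMat.{w} V)} (M : FinFamOp.Pro X Y)
    (N : FinFamOp.Pro Y Z) :
    ((universalCells.{w} V).rightAdjoint (diagonalStrongData _)).laxator M N
      = (⟨𝟙 _, 𝟙 _, piLaxator M N⟩ : Cell _ _) := by
  refine (universalCells.{w} V).cell_ext (((universalCells.{w} V).liftCell_fac _).trans ?_)
  refine FinFamOp.Cell.ext' rfl rfl (fun _ => rfl) fun p => heq_of_eq ?_
  refine Cell.ext' rfl rfl fun x z => heq_of_eq (comp_ext fun y => ?_)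
  refine Eq.trans ?_ (compι_piLaxator M N x y z p).symm
  refine Eq.trans ?_ (compι_hmap (f := fun x : ∀ i, X.x i => x (M.l p.fst))
    (g := fun y : ∀ j, Y.x j => y p.mid) (k := fun z : ∀ k, Z.x k => z (N.r p.snd))
    (piProπ M p.fst rfl p.hr) (piProπ N p.snd p.hl rfl) x y z)
  -- The inverse comparison of the diagonal contributes only an identity.
  exact congrArg (compι (piPro M) (piPro N) x y z ≫ ·) (Category.id_comp _)

/-- The components of the identity comparison for products of matrices. -/
def piUnitor (X : FinFamOp.Fam.{w} (VMat.{w} V)) (x y : ∀ i, X.x i) :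
    unit (∀ i, X.x i) x y ⟶ piPro (FinFamOp.unit X) x y :=
  unitDesc fun h => piLift (FinFamOp.unit X) fun i => unitι (x i) (y i) (congrFun h i)

theorem unitι_piUnitor (X : FinFamOp.Fam.{w} (VMat.{w} V)) (x y : ∀ i, X.x i) (h : x = y)
    (i : X.I) : unitι x y h ≫ piUnitor X x y ≫ piProπ (FinFamOp.unit X) i rfl rfl x y
      = unitι (V := V) (x i) (y i) (congrFun h i) :=
  ((Category.assoc _ _ _).symm.trans (congrArg (· ≫ _) (unitι_desc _ h))).trans
    (piLift_π (FinFamOp.unit X) _ i)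

theorem rightAdjoint_unitor (X : FinFamOp.Fam.{w} (VMat.{w} V)) :
    ((universalCells.{w} V).rightAdjoint (diagonalStrongData _)).unitor X
      = (⟨𝟙 _, 𝟙 _, piUnitor X⟩ : Cell _ _) := by
  refine (universalCells.{w} V).cell_ext (((universalCells.{w} V).liftCell_fac _).trans ?_)
  refine FinFamOp.Cell.ext' rfl rfl (fun _ => rfl) fun i => heq_of_eq ?_
  refine Cell.ext' rfl rfl fun x y => heq_of_eq (unit_ext fun h => ?_)
  refine Eq.trans ?_ (unitι_piUnitor X x y h i).symm
  refine Eq.trans ?_ (unitι_map (V := V) (fun x : ∀ i, X.x i => x i) x y h)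
  exact congrArg (unitι x y h ≫ ·) (Category.id_comp _)

end

section

open CartesianMonoidalCategory

variable {V : Type u} [Category.{v} V] [CartesianMonoidalCategory V] [HasCoproducts.{w} V]
  [DistributiveCategory.{w} V]

/-- Bijectivity of the two legs turns all the products involved into products over one index set and
identifies the `y ∈ ∏ j, Y j` with choice functions on it. The comparison then becomes the
distributive law. If the legs missed some `j`, the source would still carry a coproduct over `y_j`
with no counterpart in the target. -/
theorem isIso_piLaxator {X Y Z : FinFamOp.Fam.{w} (VMat.{w} V)} (M : FinFamOp.Pro X Y)
    (N : FinFamOp.Pro Y Z) (hM : Function.Bijective M.r) (hN : Function.Bijective N.l)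
    (x : ∀ i, X.x i) (z : ∀ k, Z.x k) : IsIso (piLaxator M N x z) := by
  let eM := Equiv.ofBijective _ hM
  let eN := Equiv.ofBijective _ hN
  -- Each leg being a bijection makes the opposite projection of the pullback a bijection: `e₁`
  -- rests on `hN` and `e₂` on `hM`. The bijection `e` with `Y.I` needs both.
  let e₁ : M.A ≃ FinFamOp.Pullback M N :=
    { toFun := fun a => ⟨a, M.r a, eN.symm (M.r a), rfl, eN.apply_symm_apply _⟩
      invFun := fun p => p.fst
      left_inv := fun _ => rfl
      right_inv := fun p => FinFamOp.Pullback.ext rfl p.hr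
        (eN.symm_apply_eq.2 (p.hr.trans p.hl.symm)) }
  let e₂ : N.A ≃ FinFamOp.Pullback M N :=
    { toFun := fun b => ⟨eM.symm (N.l b), N.l b, b, eM.apply_symm_apply _, rfl⟩
      invFun := fun p => p.snd
      left_inv := fun _ => rfl
      right_inv := fun p => FinFamOp.Pullback.ext (eM.symm_apply_eq.2 (p.hl.trans p.hr.symm))
        p.hl rfl }
  let e : FinFamOp.Pullback M N ≃ Y.I :=
    { toFun := fun p => p.mid
      invFun := fun j => ⟨eM.symm j, j, eN.symm j, eM.apply_symm_apply _, eN.apply_symm_apply _⟩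
      left_inv := fun p => FinFamOp.Pullback.ext (eM.symm_apply_eq.2 p.hr.symm) rfl
        (eN.symm_apply_eq.2 p.hl.symm)
      right_inv := fun _ => rfl }
  -- With `x` and `z` fixed, the factors at `p` depend on `y` only through its coordinate at
  -- `p.mid`. This independence of coordinates is what permits distribution.
  let F (p : FinFamOp.Pullback M N) (j : Y.x p.mid) : V := M.m p.fst rfl p.hr (x (M.l p.fst)) j
  let G (p : FinFamOp.Pullback M N) (j : Y.x p.mid) : V := N.m p.snd p.hl rfl j (z (N.r p.snd))
  let f (y : ∀ j, Y.x j) (p : FinFamOp.Pullback M N) : piPro M x y ⟶ F p (y p.mid) :=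
    piProπ M p.fst rfl p.hr x y
  let g (y : ∀ j, Y.x j) (p : FinFamOp.Pullback M N) : piPro N y z ⟶ G p (y p.mid) :=
    piProπ N p.snd p.hl rfl y z
  -- Pulled back along `e₁`, the arrows `f y` are the defining projections of `piPro M x y`, so
  -- their pairing is the identity.
  have hf : ∀ y, IsIso (Pi.lift (f y)) := fun y => by
    refine isIso_piLift_of_equiv e₁ _ ?_
    have : (Pi.lift fun a => f y (e₁ a)) = 𝟙 (piPro M x y) :=
      Pi.hom_ext _ _ fun a => (Pi.lift_π _ _).trans (Category.id_comp _).symm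
    rw [this]
    exact IsIso.id _
  have hg : ∀ y, IsIso (Pi.lift (g y)) := fun y => by
    refine isIso_piLift_of_equiv e₂ _ ?_
    have : (Pi.lift fun a => g y (e₂ a)) = 𝟙 (piPro N y z) :=
      Pi.hom_ext _ _ fun a => (Pi.lift_π _ _).trans (Category.id_comp _).symm
    rw [this]
    exact IsIso.id _
  -- The leg at `y` corresponds to the leg of the distributive law at the choice function `p ↦ y
  -- p.mid`. The sources are compared by regrouping a product of two products as a product of binary
  -- products.
  have key := (isIso_sigmaDesc_iff_of_equiv (Equiv.piCongrLeft (fun j => Y.x j) e).symm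
    (fun y => compι (piPro M) (piPro N) x y z ≫ piLaxator M N x z) _
    (fun y => Pi.lift fun p => f y p ⊗ₘ g y p)
    (fun y => isIso_piLift_tensorHom _ _ (hf y) (hg y)) (𝟙 _)
    inferInstance fun y => ?_).2 (isIso_sigmaDesc_piMap (FinFamOp.Pullback M N)
      (fun p => Y.x p.mid) fun p j => F p j ⊗ G p j)
  -- The comparison is recovered from its restrictions to the summands; the remaining goal is
  -- agreement of the legs, checked on projections.
  · have e : Sigma.desc (fun y => compι (piPro M) (piPro N) x y z ≫ piLaxator M N x z)
        = piLaxator M N x z := Sigma.hom_ext _ _ fun y => Sigma.ι_desc _ _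
    rwa [e] at key
  · refine Pi.hom_ext _ _ fun p => ?_
    exact ((congrArg (· ≫ _) (Category.comp_id _)).trans (Category.assoc _ _ _)).trans
      ((compι_piLaxator M N x y z p).trans (piLift_piMap_π (fun p => f y p ⊗ₘ g y p)
        (fun p => compι (M.m p.fst rfl p.hr) (N.m p.snd p.hl rfl) (x (M.l p.fst)) (y p.mid)
          (z (N.r p.snd))) p).symm)

/-- No bijectivity assumption is needed, because the identity family is indexed by the identity
span. The distributive law is applied to coproducts indexed by proofs of equality; off the diagonal
it covers the case where some factor is initial. -/
theorem isIso_piUnitor (X : FinFamOp.Fam.{w} (VMat.{w} V)) (x y : ∀ i, X.x i) :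
    IsIso (piUnitor X x y) := by
  -- Function extensionality, read as a bijection between proofs of `x = y` and choice functions of
  -- coordinatewise proofs.
  let σ : ULift.{w} (PLift (x = y)) ≃ ∀ i, ULift.{w} (PLift (x i = y i)) :=
    { toFun := fun h i => ⟨⟨congrFun h.down.down i⟩⟩
      invFun := fun h => ⟨⟨funext fun i => (h i).down.down⟩⟩
      left_inv := fun _ => rfl
      right_inv := fun _ => rfl }
  -- This is where the tensor unit has to be terminal: the diagonal from `1` to a finite power of
  -- `1` is invertible.
  have hterm : IsIso (Pi.lift fun _ : X.I => 𝟙 (𝟙_ V)) :=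
    ⟨toUnit _, toUnit_unique _ _, Pi.hom_ext _ _ fun _ => toUnit_unique _ _⟩
  have key := (isIso_sigmaDesc_iff_of_equiv σ
    (fun h => unitι (V := V) x y h.down.down ≫ piUnitor X x y) _
    (fun _ => Pi.lift fun _ => 𝟙 _) (fun _ => hterm) (𝟙 _)
    inferInstance fun h => ?_).2 (isIso_sigmaDesc_piMap X.I
      (fun i => ULift.{w} (PLift (x i = y i))) fun _ _ => 𝟙_ V)
  · have e : Sigma.desc (fun h => unitι (V := V) x y h.down.down ≫ piUnitor X x y)
        = piUnitor X x y := Sigma.hom_ext _ _ fun y => Sigma.ι_desc _ _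
    rwa [e] at key
  · refine Pi.hom_ext _ _ fun i => ?_
    exact ((congrArg (· ≫ _) (Category.comp_id _)).trans (Category.assoc _ _ _)).trans
      ((unitι_piUnitor X x y h.down.down i).trans ((piLift_piMap_π (fun i => 𝟙 (𝟙_ V))
        (fun i => unitι (x i) (y i) (congrFun h.down.down i)) i).trans (Category.id_comp _)).symm)

end

end VMat

end

/-- For every distributive category `V`, the double category of `V`-matrices has iso-strong finite
products. -/
theorem mainTheorem6 (V : Type u) [Category.{v} V] [CartesianMonoidalCategory V]
    [HasCoproducts.{w} V] [DistributiveCategory.{w} V] :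
    HasIsoStrongFiniteProducts.{w} (VMat.{w} V) := by
  refine ⟨_, (VMat.universalCells.{w} V).adjunction (diagonalStrongData _), ?_, ?_⟩
  · intro X Y Z M N hM hN
    rw [VMat.rightAdjoint_laxator]
    exact VMat.isIsoCell _ (VMat.isIso_piLaxator M N hM hN)
  · intro X
    rw [VMat.rightAdjoint_unitor]
    exact VMat.isIsoCell _ (VMat.isIso_piUnitor X)
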